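/- Let $k\ge 1$ be an integer and $d=4k+3$. There is a constant $C$, depending only on $d$, such that the following holds for every finite field $\mathbb F_q$ with $q$ elements, $q\equiv 3 \bmod 4$, and every non-trivial additive character $\chi$ of $\mathbb F_q$. Let $$P=\{x\in\mathbb F_q^d : x_d=x_1^2+\cdots+x_{d-1}^2\},$$ and for $f\colon P\to\mathbb C$ put $(f\,d\sigma)^\vee(m)=\frac1{|P|}\sum_{x\in P}\chi(m\cdot x)f(x)$ for $m\in\mathbb F_q^d$. Let $R_P^*(2\to r)$ denote the least real number $R\ge 0$ such that $$\Big(\sum_{m\in\mathbb F_q^d}|(f\,d\sigma)^\vee(m)|^r\Big)^{1/r}\le R\,\Big(\frac1{|P|}\sum_{x\in P}|f(x)|^2\Big)^{1/2}\qquad\text{for all } f\colon P\to\mathbb C .$$ Then $$R_P^*\Big(2\to\frac{2d+4}{d}\Big)\le C .$$ -/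

import Mathlib

open scoped NNReal ENNReal

noncomputable section

namespace FiniteFieldExtension

variable {F : Type*} [Field F] [Fintype F]

/-- The paraboloid `x_d = x_1 ^ 2 + ⋯ + x_{d-1} ^ 2` in `F ^ d`, where `d = n + 1`. -/
def paraboloid (F : Type*) [Field F] [Fintype F] [DecidableEq F] (n : ℕ) :
    Finset (Fin (n + 1) → F) :=
  Finset.univ.filter fun x => x (Fin.last n) = ∑ i : Fin n, x i.castSucc ^ 2

/-- The inverse Fourier transform `(f dσ)^∨` of `f dσ`, with `dσ` the normalized surface measure
on `V`: `m ↦ |V|⁻¹ ∑_{x ∈ V} χ (m · x) f x`. -/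
def extension {d : ℕ} (χ : AddChar F ℂ) (V : Finset (Fin d → F)) (f : (Fin d → F) → ℂ)
    (m : Fin d → F) : ℂ :=
  (V.card : ℂ)⁻¹ * ∑ x ∈ V, χ (dotProduct m x) * f x

/-- The norm of `L ^ r (F ^ d, dc)`, with `dc` the counting measure, for `1 ≤ r < ∞`. -/
def normCount {d : ℕ} (r : ℝ) (g : (Fin d → F) → ℂ) : ℝ :=
  (∑ m, ‖g m‖ ^ r) ^ (1 / r)

/-- The norm of `L ^ p (V, dσ)`, with `dσ` the normalized surface measure, for `1 ≤ p < ∞`. -/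
def normSurface {d : ℕ} (V : Finset (Fin d → F)) (p : ℝ) (f : (Fin d → F) → ℂ) : ℝ :=
  ((V.card : ℝ)⁻¹ * ∑ x ∈ V, ‖f x‖ ^ p) ^ (1 / p)

/-- `C` is an admissible constant in the `L ^ p → L ^ r` extension inequality for `V`. Both sides
depend only on the values of `f` on `V`, so that `f` ranges over all functions on `V`. -/
def IsExtensionBound {d : ℕ} (χ : AddChar F ℂ) (V : Finset (Fin d → F)) (p r : ℝ) (C : ℝ≥0) :
    Prop :=
  ∀ f : (Fin d → F) → ℂ, normCount r (extension χ V f) ≤ C * normSurface V p f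

/-- The extension constant `R_V^* (p → r)`: the least admissible constant in the extension
inequality (and `∞` if there were none). -/
def extensionConstant {d : ℕ} (χ : AddChar F ℂ) (V : Finset (Fin d → F)) (p r : ℝ) : ℝ≥0∞ :=
  ⨅ (C : ℝ≥0) (_ : IsExtensionBound χ V p r C), (C : ℝ≥0∞)

end FiniteFieldExtension

end

noncomputable section

namespace FiniteFieldExtension

open scoped ComplexConjugate

set_option linter.unusedSectionVars false

/-! ### Additive characters and quadratic Gauss sums. -/

section CharacterSums

variable {F : Type*} [Field F] [Fintype F] [DecidableEq F] {χ : AddChar F ℂ}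

/-! Write d = 2h + 1 with h odd and h ≥ 3. Since -1 is not a square, a one-variable Gauss sum
squares to -q, so the Gauss sum in 2h variables is exactly -q^h. Only the modulus matters for the
decay of the surface measure, but the sign matters for counting pairs of E with (x - y)·(x - y) = 0.
The Fourier side of that count is a sum over the null cone, which enters with a minus sign and can
be discarded. The error term is then smaller by a factor q than absolute values would give
(`card_mul_nullPairCount_le`).

Null pairs control the variance of the number of right angles in E
(`sq_card_mul_rightAngleCount_sub_le`), and right angles are the additive quadruples of the
paraboloid lifted from E. By completing the square, convolution with the surface kernel at nonzero
height is again an extension operator of the paraboloid, so its fourth moment is governed by the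
same count (`sum_norm_pow_four_surfaceKernel_le`).

By duality, level sets of the extension are bounded by L² restriction estimates. A TT* expansion
gives two: one from pointwise decay of the kernel, one from Hölder and the right angles in
horizontal slices (`sq_mul_sq_card_le`). For a normalized f and r = 2 + 4/d, Parseval handles the
values below q^(-d/4). Above that threshold, decay handles t > √2 q^(-h/2) and the energy bound
handles the rest (`rpow_mul_le_levelProfile`). Every resulting bound for t^r |{t ≤ |u|}| is a
positive power of t₀/t, t or t/T, so the dyadic sum is geometric and the endpoint is reached without
a logarithm. -/

lemma sum_addChar_mul (hχ : χ ≠ 1) (b : F) :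
    ∑ x, χ (b * x) = if b = 0 then (Fintype.card F : ℂ) else 0 := by
  have h := AddChar.sum_mulShift b (AddChar.IsPrimitive.of_ne_one hχ)
  simp_rw [mul_comm b, h]
  split_ifs <;> simp

lemma sum_addChar_mul_erase_zero (hχ : χ ≠ 1) (b : F) :
    ∑ x ∈ Finset.univ.erase (0 : F), χ (b * x) =
      (if b = 0 then (Fintype.card F : ℂ) else 0) - 1 := by
  rw [← sum_addChar_mul hχ b, ← Finset.add_sum_erase _ _ (Finset.mem_univ (0 : F))]
  simp

lemma addChar_sum {ι : Type*} (s : Finset ι) (f : ι → F) :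
    χ (∑ i ∈ s, f i) = ∏ i ∈ s, χ (f i) := by
  classical
  induction s using Finset.induction_on with
  | empty => simp
  | insert a s ha ih => rw [Finset.sum_insert ha, Finset.prod_insert ha, AddChar.map_add_eq_mul, ih]

lemma addChar_mul_conj (x y : F) : χ x * conj (χ y) = χ (x - y) := by
  rw [← AddChar.map_neg_eq_conj, ← AddChar.map_add_eq_mul, sub_eq_add_neg]

variable {ι : Type*} [Fintype ι]

lemma sum_prod_apply [DecidableEq ι] {R : Type*} [CommSemiring R] (f : ι → F → R) :
    ∑ v : ι → F, ∏ i, f i (v i) = ∏ i, ∑ x, f i x := by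
  rw [Finset.prod_univ_sum, Fintype.piFinset_univ]

lemma sum_addChar_dotProduct [DecidableEq ι] (hχ : χ ≠ 1) (u : ι → F) :
    ∑ v : ι → F, χ (u ⬝ᵥ v) =
      if u = 0 then (Fintype.card F : ℂ) ^ Fintype.card ι else 0 := by
  simp_rw [dotProduct, addChar_sum]
  rw [sum_prod_apply (fun i x => χ (u i * x))]
  simp_rw [sum_addChar_mul hχ]
  split_ifs with h
  · simp [h]
  · obtain ⟨i, hi⟩ := Function.ne_iff.mp h
    exact Finset.prod_eq_zero (Finset.mem_univ i) (by simpa using hi)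

/-- **Parseval's identity** for a family of functions on a finite set whose Gram matrix is `N`
times the indicator of a relation. -/
lemma sum_norm_sq_sum_mul {M J : Type*} [Fintype M] (s : Finset J) (g : J → ℂ) (e : M → J → ℂ)
    (R : J → J → Prop) [DecidableRel R] (N : ℂ)
    (h : ∀ i ∈ s, ∀ j ∈ s, ∑ m, e m i * conj (e m j) = if R i j then N else 0) :
    ((∑ m, ‖∑ i ∈ s, g i * e m i‖ ^ 2 : ℝ) : ℂ) =
      N * ∑ i ∈ s, ∑ j ∈ s, if R i j then g i * conj (g j) else 0 := by
  push_cast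
  simp_rw [← Complex.mul_conj', map_sum, map_mul, Finset.sum_mul_sum]
  rw [Finset.sum_comm, Finset.mul_sum]
  refine Finset.sum_congr rfl fun i hi => ?_
  rw [Finset.sum_comm, Finset.mul_sum]
  refine Finset.sum_congr rfl fun j hj => ?_
  have : ∀ m, g i * e m i * (conj (g j) * conj (e m j)) =
      g i * conj (g j) * (e m i * conj (e m j)) := fun m => by ring
  simp_rw [this, ← Finset.mul_sum, h i hi j hj]
  split_ifs <;> ring

lemma two_ne_zero_of_card (hq : Fintype.card F % 4 = 3) : (2 : F) ≠ 0 := by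
  refine Ring.two_ne_zero fun h => ?_
  have := FiniteField.even_card_of_char_two h
  omega

lemma four_ne_zero_of_card (hq : Fintype.card F % 4 = 3) : (4 : F) ≠ 0 := by
  rw [show (4 : F) = 2 * 2 by norm_num]
  exact mul_ne_zero (two_ne_zero_of_card hq) (two_ne_zero_of_card hq)

lemma quadraticChar_neg_of_card (hq : Fintype.card F % 4 = 3) (a : F) :
    quadraticChar F (-a) = -quadraticChar F a := by
  have h1 : quadraticChar F (-1 : F) = -1 := by
    rw [quadraticChar_neg_one_iff_not_isSquare, FiniteField.isSquare_neg_one_iff]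
    simpa using hq
  rw [← neg_one_mul a, map_mul, h1, neg_one_mul]

lemma sum_comp_sq {R : Type*} [CommRing R] (h2 : ringChar F ≠ 2) (f : F → R) :
    ∑ x, f (x ^ 2) = ∑ a, ((quadraticChar F a : R) + 1) * f a := by
  rw [← Finset.sum_fiberwise (s := Finset.univ) (g := fun x : F => x ^ 2)]
  refine Finset.sum_congr rfl fun a _ => ?_
  have hc := quadraticChar_card_sqrts h2 a
  rw [Finset.sum_congr rfl (g := fun _ => f a)
    (fun x hx => by rw [(Finset.mem_filter.mp hx).2]), Finset.sum_const, nsmul_eq_mul]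
  congr 1
  have : (({x : F | x ^ 2 = a}.toFinset.card : ℤ) : R) = ((quadraticChar F a + 1 : ℤ) : R) := by
    rw [hc]
  push_cast at this
  rw [← this]
  congr 2
  ext x
  simp

/-- When `-1` is not a square, a quadratic Gauss sum is purely imaginary. -/
lemma sum_addChar_sq_conj (hq : Fintype.card F % 4 = 3) (hχ : χ ≠ 1) {s : F} (hs : s ≠ 0) :
    conj (∑ x, χ (s * x ^ 2)) = -∑ x, χ (s * x ^ 2) := by
  have h2 : ringChar F ≠ 2 := fun h => by
    have := FiniteField.even_card_of_char_two h
    omega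
  -- The number of square roots of a is η(a) + 1 with η the quadratic character, which is odd. The
  -- two sums therefore add up to twice a complete character sum, which vanishes.
  have key : (∑ x, χ (-(s * x ^ 2))) + ∑ x, χ (s * x ^ 2) = 0 := by
    rw [sum_comp_sq h2 (fun a => χ (-(s * a))), sum_comp_sq h2 (fun a => χ (s * a)),
      ← Equiv.sum_comp (Equiv.neg F), ← Finset.sum_add_distrib]
    simp only [Equiv.neg_apply, mul_neg, neg_neg, quadraticChar_neg_of_card hq]
    have : ∀ a : F, (((-quadraticChar F a : ℤ) : ℂ) + 1) * χ (s * a) +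
        (((quadraticChar F a : ℤ) : ℂ) + 1) * χ (s * a) = 2 * χ (s * a) := fun a => by
      push_cast; ring
    simp_rw [this, ← Finset.mul_sum, sum_addChar_mul hχ, if_neg hs, mul_zero]
  rw [map_sum]
  simp_rw [← AddChar.map_neg_eq_conj]
  exact eq_neg_of_add_eq_zero_left key

lemma sum_addChar_sq_mul_conj (h2 : (2 : F) ≠ 0) (hχ : χ ≠ 1) {s : F} (hs : s ≠ 0) :
    (∑ x, χ (s * x ^ 2)) * conj (∑ x, χ (s * x ^ 2)) = Fintype.card F := by
  rw [map_sum, Finset.sum_mul_sum]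
  simp_rw [addChar_mul_conj]
  have : ∀ x : F, ∑ y, χ (s * x ^ 2 - s * y ^ 2) = ∑ u, χ (-(s * u ^ 2)) * χ ((2 * s * u) * x) := by
    intro x
    rw [← Equiv.sum_comp (Equiv.subLeft x)]
    refine Finset.sum_congr rfl fun u _ => ?_
    rw [← AddChar.map_add_eq_mul, Equiv.subLeft_apply]
    congr 1
    ring
  simp_rw [this]
  rw [Finset.sum_comm]
  simp_rw [← Finset.mul_sum, sum_addChar_mul hχ]
  simp [h2, hs]

lemma sum_addChar_sq_sq (hq : Fintype.card F % 4 = 3) (hχ : χ ≠ 1) {s : F} (hs : s ≠ 0) :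
    (∑ x, χ (s * x ^ 2)) ^ 2 = -(Fintype.card F : ℂ) := by
  have h := sum_addChar_sq_mul_conj (two_ne_zero_of_card hq) hχ hs
  rw [sum_addChar_sq_conj hq hχ hs] at h
  rw [← h]
  ring

/-- In dimension `2h` with `h` odd, the quadratic Gauss sum is `-q ^ h` if `q ≡ 3 mod 4`. -/
lemma sum_addChar_dotProduct_self [DecidableEq ι] (hq : Fintype.card F % 4 = 3) (hχ : χ ≠ 1)
    {h : ℕ} (hh : Odd h) (hι : Fintype.card ι = 2 * h) {s : F} (hs : s ≠ 0) :
    ∑ p : ι → F, χ (s * (p ⬝ᵥ p)) = -(Fintype.card F : ℂ) ^ h := by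
  simp_rw [dotProduct, Finset.mul_sum, addChar_sum, ← sq]
  rw [sum_prod_apply (fun _ x => χ (s * x ^ 2)), Finset.prod_const, Finset.card_univ, hι, pow_mul,
    sum_addChar_sq_sq hq hχ hs, hh.neg_pow]

/-- The Fourier transform of a quadratic phase, by completing the square. -/
lemma sum_addChar_dotProduct_add_self [DecidableEq ι] (hq : Fintype.card F % 4 = 3) (hχ : χ ≠ 1)
    {h : ℕ} (hh : Odd h) (hι : Fintype.card ι = 2 * h) {t : F} (ht : t ≠ 0) (y : ι → F) :
    ∑ p : ι → F, χ (p ⬝ᵥ y + t * (p ⬝ᵥ p)) =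
      -(Fintype.card F : ℂ) ^ h * χ (-(4 * t)⁻¹ * (y ⬝ᵥ y)) := by
  have h2 := two_ne_zero_of_card hq
  have h4 := four_ne_zero_of_card hq
  rw [← sum_addChar_dotProduct_self hq hχ hh hι ht,
    ← Equiv.sum_comp (Equiv.subRight ((2 * t)⁻¹ • y)), Finset.sum_mul]
  refine Finset.sum_congr rfl fun p _ => ?_
  rw [← AddChar.map_add_eq_mul]
  congr 1
  simp only [Equiv.subRight_apply, sub_dotProduct, dotProduct_sub, smul_dotProduct,
    dotProduct_smul, smul_eq_mul, dotProduct_comm y p]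
  field_simp
  ring

end CharacterSums

/-! ### Null pairs and right angles in subsets of an even-dimensional space. -/

section Counting

variable {F : Type*} [Field F] [Fintype F] [DecidableEq F] {χ : AddChar F ℂ}
variable {ι : Type*} [Fintype ι] [DecidableEq ι]

/-- The number of ordered pairs of points of `E` at distance zero. -/
def nullPairCount (E : Finset (ι → F)) : ℕ :=
  ∑ x ∈ E, (E.filter fun y => (x - y) ⬝ᵥ (x - y) = 0).card

/-- The number of triples of points of `E` that form a right angle at the third point. -/
def rightAngleCount (E : Finset (ι → F)) : ℕ :=
  ∑ x ∈ E, ∑ y ∈ E, (E.filter fun z => (x - z) ⬝ᵥ (y - z) = 0).card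

lemma card_filter_eq_sum_addChar (hχ : χ ≠ 1) {J : Type*} (s : Finset J) (f : J → F) :
    (Fintype.card F : ℂ) * ((s.filter fun j => f j = 0).card : ℂ) =
      s.card + ∑ j ∈ s, ∑ t ∈ Finset.univ.erase (0 : F), χ (f j * t) := by
  simp_rw [sum_addChar_mul_erase_zero hχ, Finset.sum_sub_distrib, ← Finset.sum_filter]
  simp only [Finset.sum_const, nsmul_eq_mul, mul_one]
  ring

lemma sum_addChar_dotProduct_mul_conj (hχ : χ ≠ 1) (u v : ι → F) :
    ∑ m : ι → F, χ (u ⬝ᵥ m) * conj (χ (v ⬝ᵥ m)) =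
      if u = v then (Fintype.card F : ℂ) ^ Fintype.card ι else 0 := by
  simp_rw [addChar_mul_conj, ← sub_dotProduct, sum_addChar_dotProduct hχ, sub_eq_zero]

lemma sum_norm_sq_sum_addChar (hχ : χ ≠ 1) (E : Finset (ι → F)) :
    ∑ p : ι → F, ‖∑ x ∈ E, χ (x ⬝ᵥ p)‖ ^ 2 =
      (Fintype.card F : ℝ) ^ Fintype.card ι * E.card := by
  have h := sum_norm_sq_sum_mul E (fun _ => 1) (fun p x => χ (x ⬝ᵥ p)) (fun x y => x = y) _
    (fun u _ v _ => sum_addChar_dotProduct_mul_conj hχ u v)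
  have h' : ((∑ p : ι → F, ‖∑ x ∈ E, χ (x ⬝ᵥ p)‖ ^ 2 : ℝ) : ℂ) =
      (((Fintype.card F : ℝ) ^ Fintype.card ι * E.card : ℝ) : ℂ) := by
    simpa using h
  exact_mod_cast h'

/-- The involution t ↦ -(4t)⁻¹ of the nonzero elements is the action of the Fourier transform on the
parameter of a quadratic phase. -/
lemma sum_neg_inv_four_mul (h4 : (4 : F) ≠ 0) {R : Type*} [AddCommMonoid R] (f : F → R) :
    ∑ t ∈ Finset.univ.erase (0 : F), f (-(4 * t)⁻¹) = ∑ t ∈ Finset.univ.erase (0 : F), f t := by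
  refine Finset.sum_nbij' (fun t => -(4 * t)⁻¹) (fun t => -(4 * t)⁻¹) ?_ ?_ ?_ ?_ ?_
  · intro t ht; simp_all
  · intro t ht; simp_all
  · intro t ht
    have : t ≠ 0 := by simpa using ht
    field_simp
  · intro t ht
    have : t ≠ 0 := by simpa using ht
    field_simp
  · intro t ht; rfl

/-- The number of null pairs, bounded one-sidedly thanks to the sign of the Gauss sum. -/
lemma card_mul_nullPairCount_le (hq : Fintype.card F % 4 = 3) (hχ : χ ≠ 1)
    {h : ℕ} (hh : Odd h) (hι : Fintype.card ι = 2 * h) (E : Finset (ι → F)) :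
    (Fintype.card F : ℝ) * nullPairCount E ≤
      (E.card : ℝ) ^ 2 + (Fintype.card F : ℝ) ^ h * E.card := by
  set q := Fintype.card F
  have hq0 : (0 : ℝ) < q := by exact_mod_cast Fintype.card_pos
  set W : (ι → F) → ℝ := fun p => ‖∑ x ∈ E, χ (x ⬝ᵥ p)‖ ^ 2 with hW
  have key : ((q : ℂ) ^ h) * (q * nullPairCount E - (E.card : ℂ) ^ 2) =
      -∑ p : ι → F, (W p : ℂ) * ((if p ⬝ᵥ p = 0 then (q : ℂ) else 0) - 1) := by
    have h1 : (q : ℂ) * nullPairCount E - (E.card : ℂ) ^ 2 =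
        ∑ x ∈ E, ∑ y ∈ E, ∑ t ∈ Finset.univ.erase (0 : F), χ (t * ((x - y) ⬝ᵥ (x - y))) := by
      rw [nullPairCount]
      push_cast
      rw [Finset.mul_sum]
      simp_rw [q, card_filter_eq_sum_addChar hχ E]
      rw [Finset.sum_add_distrib]
      simp [sq, mul_comm]
    have h2 : ∀ x y : ι → F, (q : ℂ) ^ h *
        ∑ t ∈ Finset.univ.erase (0 : F), χ (t * ((x - y) ⬝ᵥ (x - y))) =
        -∑ t ∈ Finset.univ.erase (0 : F), ∑ p : ι → F, χ (p ⬝ᵥ (x - y) + t * (p ⬝ᵥ p)) := by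
      intro x y
      rw [← sum_neg_inv_four_mul (four_ne_zero_of_card hq), Finset.mul_sum,
        ← Finset.sum_neg_distrib]
      refine Finset.sum_congr rfl fun t ht => ?_
      rw [sum_addChar_dotProduct_add_self hq hχ hh hι (Finset.ne_of_mem_erase ht)]
      ring
    rw [h1, Finset.mul_sum]
    simp_rw [Finset.mul_sum _ _ ((q : ℂ) ^ h)] at h2 ⊢
    simp_rw [h2, Finset.sum_neg_distrib]
    congr 1
    have h3 : ∀ x ∈ E, ∀ y ∈ E,
        ∑ t ∈ Finset.univ.erase (0 : F), ∑ p : ι → F, χ (p ⬝ᵥ (x - y) + t * (p ⬝ᵥ p)) =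
        ∑ p : ι → F, (χ (x ⬝ᵥ p) * conj (χ (y ⬝ᵥ p))) *
          ((if p ⬝ᵥ p = 0 then (q : ℂ) else 0) - 1) := by
      intro x _ y _
      rw [Finset.sum_comm]
      refine Finset.sum_congr rfl fun p _ => ?_
      rw [← sum_addChar_mul_erase_zero hχ, Finset.mul_sum]
      refine Finset.sum_congr rfl fun t _ => ?_
      rw [addChar_mul_conj, ← AddChar.map_add_eq_mul, dotProduct_sub, dotProduct_comm x,
        dotProduct_comm y, mul_comm t]
    rw [Finset.sum_congr rfl fun x hx => Finset.sum_congr rfl (h3 x hx)]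
    simp_rw [Finset.sum_comm (s := E) (t := Finset.univ), ← Finset.sum_mul]
    refine Finset.sum_congr rfl fun p _ => ?_
    rw [hW]
    push_cast
    rw [← Complex.mul_conj', map_sum, Finset.sum_mul_sum]
  have key' : ((q : ℝ) ^ h) * (q * nullPairCount E - (E.card : ℝ) ^ 2) =
      -∑ p : ι → F, W p * ((if p ⬝ᵥ p = 0 then (q : ℝ) else 0) - 1) := by
    apply Complex.ofReal_injective
    push_cast
    rw [key]
    congr 1
    refine Finset.sum_congr rfl fun p _ => ?_
    split_ifs <;> simp
  -- The minus sign of the Gauss sum makes the null-cone terms non-positive, so each p contributes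
  -- at most W p; with the opposite sign the bound would carry an extra factor q.
  have hle : -∑ p : ι → F, W p * ((if p ⬝ᵥ p = 0 then (q : ℝ) else 0) - 1) ≤ ∑ p, W p := by
    rw [← Finset.sum_neg_distrib]
    refine Finset.sum_le_sum fun p _ => ?_
    have : 0 ≤ W p := sq_nonneg _
    split_ifs <;> nlinarith
  rw [← key', sum_norm_sq_sum_addChar hχ E, hι, two_mul, pow_add, mul_assoc] at hle
  have := le_of_mul_le_mul_left hle (pow_pos hq0 h)
  linarith

/-- The contribution of a single point to the second moment over hyperplanes. -/
lemma sum_smul_eq_smul_addChar (hχ : χ ≠ 1) (A : Finset (ι → F)) (u : ι → F) :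
    ∑ s ∈ Finset.univ.erase (0 : F), ∑ u' ∈ A, ∑ s' ∈ Finset.univ.erase (0 : F),
      (if s • u = s' • u' then χ (s * (u ⬝ᵥ u)) * conj (χ (s' * (u' ⬝ᵥ u'))) else 0) =
    ∑ l ∈ Finset.univ.erase (0 : F), if l • u ∈ A then
      ((if (u ⬝ᵥ u) * (1 - l) = 0 then (Fintype.card F : ℂ) else 0) - 1) else 0 := by
  -- With l = s / s' the constraint says u' = l u, and the phase s (u·u) - s' (u'·u') becomes s
  -- (u·u)(1 - l).
  have h1 : ∀ s ∈ Finset.univ.erase (0 : F),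
      ∑ u' ∈ A, ∑ s' ∈ Finset.univ.erase (0 : F),
        (if s • u = s' • u' then χ (s * (u ⬝ᵥ u)) * conj (χ (s' * (u' ⬝ᵥ u'))) else 0) =
      ∑ l ∈ Finset.univ.erase (0 : F),
        if l • u ∈ A then χ (((u ⬝ᵥ u) * (1 - l)) * s) else 0 := by
    intro s hs
    have hs0 : s ≠ 0 := Finset.ne_of_mem_erase hs
    rw [Finset.sum_comm]
    refine Finset.sum_nbij' (fun s' => s'⁻¹ * s) (fun l => l⁻¹ * s) ?_ ?_ ?_ ?_ ?_
    · intro t ht; simp_all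
    · intro t ht; simp_all
    · intro t ht
      have : t ≠ 0 := by simpa using ht
      field_simp
    · intro t ht
      have : t ≠ 0 := by simpa using ht
      field_simp
    · intro s' hs'
      have hs'0 : s' ≠ 0 := Finset.ne_of_mem_erase hs'
      have hiff : ∀ u' : ι → F, (s • u = s' • u') ↔ (s'⁻¹ * s) • u = u' := by
        intro u'
        rw [mul_smul, inv_smul_eq_iff₀ hs'0]
      simp_rw [hiff, Finset.sum_ite_eq]
      refine if_congr Iff.rfl ?_ rfl
      rw [addChar_mul_conj]
      congr 1
      simp only [smul_dotProduct, dotProduct_smul, smul_eq_mul]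
      field_simp
  rw [Finset.sum_congr rfl h1, Finset.sum_comm]
  refine Finset.sum_congr rfl fun l _ => ?_
  by_cases hl : l • u ∈ A
  · simp only [if_pos hl]
    rw [← sum_addChar_mul_erase_zero hχ]
  · simp [hl]

/-- By Parseval only pairs of collinear points u, l u of A interact. If u·u ≠ 0 the sum over s has
positive value only for l = 1, costing at most q. If u is null, each of the fewer than q dilates may
cost up to q. -/
lemma sum_norm_sq_hyperplane_le (hχ : χ ≠ 1) (A : Finset (ι → F)) :
    ∑ v : ι → F, ‖∑ u ∈ A, ∑ s ∈ Finset.univ.erase (0 : F), χ (s * (u ⬝ᵥ v + u ⬝ᵥ u))‖ ^ 2 ≤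
      (Fintype.card F : ℝ) ^ Fintype.card ι * ((Fintype.card F : ℝ) * A.card +
        (Fintype.card F : ℝ) ^ 2 * (A.filter fun u => u ⬝ᵥ u = 0).card) := by
  set q := Fintype.card F
  have hq1 : (1 : ℝ) ≤ q := by exact_mod_cast Fintype.card_pos
  have hP := sum_norm_sq_sum_mul (A ×ˢ Finset.univ.erase (0 : F))
    (fun j => χ (j.2 * (j.1 ⬝ᵥ j.1))) (fun v j => χ ((j.2 • j.1) ⬝ᵥ v))
    (fun i j => i.2 • i.1 = j.2 • j.1) ((q : ℂ) ^ Fintype.card ι)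
    (fun i _ j _ => sum_addChar_dotProduct_mul_conj hχ _ _)
  simp_rw [Finset.sum_product] at hP
  simp_rw [sum_smul_eq_smul_addChar hχ A] at hP
  have hL : ∀ v u : ι → F, ∀ s : F, χ (s * (u ⬝ᵥ u)) * χ ((s • u) ⬝ᵥ v) =
      χ (s * (u ⬝ᵥ v + u ⬝ᵥ u)) := by
    intro v u s
    rw [← AddChar.map_add_eq_mul, smul_dotProduct, smul_eq_mul]
    congr 1
    ring
  simp_rw [hL] at hP
  have hP' : ∑ v : ι → F,
      ‖∑ u ∈ A, ∑ s ∈ Finset.univ.erase (0 : F), χ (s * (u ⬝ᵥ v + u ⬝ᵥ u))‖ ^ 2 =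
      (q : ℝ) ^ Fintype.card ι * ∑ u ∈ A, ∑ l ∈ Finset.univ.erase (0 : F), if l • u ∈ A then
        ((if (u ⬝ᵥ u) * (1 - l) = 0 then (q : ℝ) else 0) - 1) else 0 := by
    apply Complex.ofReal_injective
    rw [hP]
    push_cast
    congr 1
    refine Finset.sum_congr rfl fun u _ => Finset.sum_congr rfl fun l _ => ?_
    split_ifs <;> simp [q]
  rw [hP']
  refine mul_le_mul_of_nonneg_left ?_ (by positivity)
  rw [Finset.card_filter, Finset.card_eq_sum_ones]
  push_cast
  rw [Finset.mul_sum, Finset.mul_sum, ← Finset.sum_add_distrib]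
  refine Finset.sum_le_sum fun u _ => ?_
  by_cases hu : u ⬝ᵥ u = 0
  · simp only [hu, zero_mul, if_true, mul_one]
    calc _ ≤ ∑ l ∈ Finset.univ.erase (0 : F), (q : ℝ) :=
          Finset.sum_le_sum fun l _ => by split_ifs <;> linarith
      _ ≤ (q : ℝ) * q := by
          rw [Finset.sum_const, nsmul_eq_mul]
          gcongr
          exact Finset.card_le_univ _
      _ ≤ _ := by nlinarith
  · simp only [hu, if_false, mul_zero, add_zero, mul_one, mul_eq_zero, false_or]
    calc _ ≤ ∑ l ∈ Finset.univ.erase (0 : F), if 1 = l then (q : ℝ) else 0 :=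
          Finset.sum_le_sum fun l _ => by
            simp only [sub_eq_zero]
            split_ifs <;> linarith
      _ ≤ _ := by
          rw [Finset.sum_ite_eq]
          split_ifs <;> linarith

/-- This is the hyperplane bound for u = x - z and v = y - x, since (x - z)·(y - z) = u·v + u·u. -/
lemma sum_norm_sq_sphere_le (hχ : χ ≠ 1) (E : Finset (ι → F)) (x : ι → F) :
    ∑ y : ι → F,
      ‖∑ z ∈ E, ∑ s ∈ Finset.univ.erase (0 : F), χ (s * ((x - z) ⬝ᵥ (y - z)))‖ ^ 2 ≤
      (Fintype.card F : ℝ) ^ Fintype.card ι * ((Fintype.card F : ℝ) * E.card +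
        (Fintype.card F : ℝ) ^ 2 * (E.filter fun z => (x - z) ⬝ᵥ (x - z) = 0).card) := by
  have hinj : Function.Injective fun z : ι → F => x - z := sub_right_injective
  have h := sum_norm_sq_hyperplane_le hχ (E.map ⟨_, hinj⟩)
  rw [← Equiv.sum_comp (Equiv.subRight x), Finset.filter_map, Finset.card_map,
    Finset.card_map] at h
  simp only [Finset.sum_map, Function.Embedding.coeFn_mk, ← dotProduct_add, Equiv.subRight_apply,
    sub_add_sub_cancel] at h
  exact h

/-- The number of right angles in a set is close to its expected value. -/
lemma sq_card_mul_rightAngleCount_sub_le (hq : Fintype.card F % 4 = 3) (hχ : χ ≠ 1)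
    {h : ℕ} (hh : Odd h) (hι : Fintype.card ι = 2 * h) (E : Finset (ι → F)) :
    ((Fintype.card F : ℝ) * rightAngleCount E - (E.card : ℝ) ^ 3) ^ 2 ≤
      (E.card : ℝ) ^ 2 * ((Fintype.card F : ℝ) ^ (2 * h) * (Fintype.card F *
        (2 * (E.card : ℝ) ^ 2 + (Fintype.card F : ℝ) ^ h * E.card))) := by
  set q := Fintype.card F
  set S : (ι → F) → (ι → F) → ℂ := fun x y =>
    ∑ z ∈ E, ∑ s ∈ Finset.univ.erase (0 : F), χ (s * ((x - z) ⬝ᵥ (y - z)))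
  have h1 : (q : ℂ) * rightAngleCount E - (E.card : ℂ) ^ 3 = ∑ x ∈ E, ∑ y ∈ E, S x y := by
    rw [rightAngleCount]
    push_cast
    simp_rw [Finset.mul_sum, q, card_filter_eq_sum_addChar hχ E, Finset.sum_add_distrib]
    simp only [Finset.sum_const, nsmul_eq_mul, S, mul_comm]
    ring
  have h2 : |(q : ℝ) * rightAngleCount E - (E.card : ℝ) ^ 3| ≤
      ∑ j ∈ E ×ˢ E, ‖S j.1 j.2‖ := by
    rw [← Real.norm_eq_abs, ← Complex.norm_real]
    push_cast
    rw [h1, ← Finset.sum_product' E E S]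
    exact norm_sum_le _ _
  rw [← sq_abs]
  calc _ ≤ (∑ j ∈ E ×ˢ E, ‖S j.1 j.2‖) ^ 2 := by gcongr
    _ ≤ ((E ×ˢ E).card : ℝ) * ∑ j ∈ E ×ˢ E, ‖S j.1 j.2‖ ^ 2 := sq_sum_le_card_mul_sum_sq
    -- Completing the sum to all y makes Parseval available for each fixed x.
    _ ≤ (E.card : ℝ) ^ 2 * ∑ x ∈ E, ∑ y, ‖S x y‖ ^ 2 := by
        rw [Finset.card_product, Finset.sum_product, sq (E.card : ℝ)]
        push_cast
        gcongr with x _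
        exact Finset.subset_univ _
    _ ≤ (E.card : ℝ) ^ 2 * ∑ x ∈ E, (q : ℝ) ^ Fintype.card ι * ((q : ℝ) * E.card +
          (q : ℝ) ^ 2 * (E.filter fun z => (x - z) ⬝ᵥ (x - z) = 0).card) := by
        gcongr with x _
        exact sum_norm_sq_sphere_le hχ E x
    _ = (E.card : ℝ) ^ 2 * ((q : ℝ) ^ (2 * h) * (q * ((E.card : ℝ) ^ 2 +
          q * nullPairCount E))) := by
        rw [← Finset.mul_sum, Finset.sum_add_distrib, ← Finset.mul_sum, nullPairCount, hι]
        push_cast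
        rw [← Finset.mul_sum]
        simp only [Finset.sum_const, nsmul_eq_mul]
        ring
    _ ≤ _ := by
        have := card_mul_nullPairCount_le hq hχ hh hι E
        refine mul_le_mul_of_nonneg_left (mul_le_mul_of_nonneg_left
          (mul_le_mul_of_nonneg_left ?_ ?_) ?_) ?_ <;> first | positivity | linarith

end Counting

/-! ### Fourth moments and L² restriction estimates. -/

section Restriction

variable {F : Type*} [Field F] [Fintype F] [DecidableEq F] {χ : AddChar F ℂ}
variable {ι : Type*} [Fintype ι] [DecidableEq ι]

/-- An additive quadruple on the paraboloid is a rectangle: w is determined by the other three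
points, and the right angle sits at z. -/
lemma dotProduct_sub_sub_eq_zero (h2 : (2 : F) ≠ 0) {x y z w : ι → F} (h : x + y = z + w)
    (h' : x ⬝ᵥ x + y ⬝ᵥ y = z ⬝ᵥ z + w ⬝ᵥ w) : (x - z) ⬝ᵥ (y - z) = 0 := by
  obtain rfl : w = x + y - z := by rw [h, add_sub_cancel_left]
  refine (mul_eq_zero.mp ?_).resolve_left h2
  simp only [dotProduct_add, dotProduct_sub, add_dotProduct, sub_dotProduct,
    dotProduct_comm y x, dotProduct_comm z x, dotProduct_comm z y] at h' ⊢
  linear_combination -h'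

/-- The extension operator of the paraboloid, applied to a function on `E`, has its fourth moment
bounded by the number of right angles in `E`. -/
lemma sum_norm_pow_four_le (h2 : (2 : F) ≠ 0) (hχ : χ ≠ 1) (E : Finset (ι → F)) (g : (ι → F) → ℂ)
    (hg : ∀ y, ‖g y‖ ≤ 1) :
    ∑ m : (ι → F) × F, ‖∑ y ∈ E, g y * χ (y ⬝ᵥ m.1 + m.2 * (y ⬝ᵥ y))‖ ^ 4 ≤
      (Fintype.card F : ℝ) ^ (Fintype.card ι + 1) * rightAngleCount E := by
  set q := Fintype.card F
  have hP := sum_norm_sq_sum_mul (M := (ι → F) × F) (E ×ˢ E) (fun i => g i.1 * g i.2)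
    (fun m i => χ ((i.1 + i.2) ⬝ᵥ m.1 + m.2 * (i.1 ⬝ᵥ i.1 + i.2 ⬝ᵥ i.2)))
    (fun i j => i.1 + i.2 = j.1 + j.2 ∧ i.1 ⬝ᵥ i.1 + i.2 ⬝ᵥ i.2 = j.1 ⬝ᵥ j.1 + j.2 ⬝ᵥ j.2)
    ((q : ℂ) ^ (Fintype.card ι + 1)) (by
      intro i _ j _
      rw [Fintype.sum_prod_type]
      have : ∀ (ξ : ι → F) (τ : F),
          χ ((i.1 + i.2) ⬝ᵥ ξ + τ * (i.1 ⬝ᵥ i.1 + i.2 ⬝ᵥ i.2)) *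
            conj (χ ((j.1 + j.2) ⬝ᵥ ξ + τ * (j.1 ⬝ᵥ j.1 + j.2 ⬝ᵥ j.2))) =
          χ ((i.1 + i.2 - (j.1 + j.2)) ⬝ᵥ ξ) *
            χ ((i.1 ⬝ᵥ i.1 + i.2 ⬝ᵥ i.2 - (j.1 ⬝ᵥ j.1 + j.2 ⬝ᵥ j.2)) * τ) := by
        intro ξ τ
        rw [addChar_mul_conj, ← AddChar.map_add_eq_mul, sub_dotProduct (i.1 + i.2)]
        congr 1
        ring
      simp_rw [this, ← Finset.mul_sum, ← Finset.sum_mul, sum_addChar_dotProduct hχ,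
        sum_addChar_mul hχ]
      simp only [sub_eq_zero, q]
      split_ifs with h1 h2 h3 h4 <;> simp_all [pow_succ])
  have hL : ∀ m : (ι → F) × F, ‖∑ y ∈ E, g y * χ (y ⬝ᵥ m.1 + m.2 * (y ⬝ᵥ y))‖ ^ 4 =
      ‖∑ i ∈ E ×ˢ E, g i.1 * g i.2 *
        χ ((i.1 + i.2) ⬝ᵥ m.1 + m.2 * (i.1 ⬝ᵥ i.1 + i.2 ⬝ᵥ i.2))‖ ^ 2 := by
    intro m
    rw [show 4 = 2 * 2 from rfl, pow_mul, ← norm_pow, sq (∑ y ∈ E, _), Finset.sum_mul_sum,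
      ← Finset.sum_product']
    congr 2
    refine Finset.sum_congr rfl fun i _ => ?_
    rw [mul_mul_mul_comm, ← AddChar.map_add_eq_mul, add_dotProduct]
    congr 2
    ring
  simp_rw [hL]
  have hpos : (0 : ℝ) ≤ ∑ m : (ι → F) × F, ‖∑ i ∈ E ×ˢ E, g i.1 * g i.2 *
        χ ((i.1 + i.2) ⬝ᵥ m.1 + m.2 * (i.1 ⬝ᵥ i.1 + i.2 ⬝ᵥ i.2))‖ ^ 2 :=
    Finset.sum_nonneg fun _ _ => sq_nonneg _
  rw [← Real.norm_of_nonneg hpos, ← Complex.norm_real, hP, norm_mul, norm_pow,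
    Complex.norm_natCast]
  refine mul_le_mul_of_nonneg_left ?_ (by positivity)
  refine (norm_sum_le _ _).trans ?_
  rw [Finset.sum_product, rightAngleCount]
  push_cast
  refine Finset.sum_le_sum fun x _ => Finset.sum_le_sum fun y _ => ?_
  refine (norm_sum_le _ _).trans ?_
  rw [Finset.sum_product, Finset.card_filter]
  push_cast
  refine Finset.sum_le_sum fun z _ => ?_
  calc _ ≤ ∑ w ∈ E, if x + y - z = w then (if (x - z) ⬝ᵥ (y - z) = 0 then (1 : ℝ) else 0)
        else 0 := by
        refine Finset.sum_le_sum fun w _ => ?_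
        by_cases hw : x + y = z + w ∧ x ⬝ᵥ x + y ⬝ᵥ y = z ⬝ᵥ z + w ⬝ᵥ w
        · rw [if_pos hw, if_pos (by rw [hw.1, add_sub_cancel_left]),
            if_pos (dotProduct_sub_sub_eq_zero h2 hw.1 hw.2)]
          simp only [norm_mul, RCLike.norm_conj]
          have h := fun v => norm_nonneg (g v)
          exact mul_le_one₀ (mul_le_one₀ (hg x) (h y) (hg y)) (mul_nonneg (h z) (h w))
            (mul_le_one₀ (hg z) (h w) (hg w))
        · rw [if_neg hw, norm_zero]
          split_ifs <;> simp
    _ ≤ _ := by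
        rw [Finset.sum_ite_eq]
        split_ifs <;> simp

/-- The inverse Fourier transform of the (unnormalized) surface measure on the paraboloid. -/
def surfaceKernel (χ : AddChar F ℂ) (y : ι → F) (t : F) : ℂ :=
  ∑ p : ι → F, χ (p ⬝ᵥ y + t * (p ⬝ᵥ p))

lemma surfaceKernel_zero (hχ : χ ≠ 1) (y : ι → F) :
    surfaceKernel χ y 0 = if y = 0 then (Fintype.card F : ℂ) ^ Fintype.card ι else 0 := by
  simp_rw [surfaceKernel, zero_mul, add_zero, dotProduct_comm _ y, sum_addChar_dotProduct hχ]

lemma norm_surfaceKernel (hq : Fintype.card F % 4 = 3) (hχ : χ ≠ 1)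
    {h : ℕ} (hh : Odd h) (hι : Fintype.card ι = 2 * h) (y : ι → F) {t : F} (ht : t ≠ 0) :
    ‖surfaceKernel χ y t‖ = (Fintype.card F : ℝ) ^ h := by
  rw [surfaceKernel, sum_addChar_dotProduct_add_self hq hχ hh hι ht]
  simp

/-- For t ≠ 0 the kernel is -q^h times a quadratic phase. Expanding the square at y = 2tξ turns the
convolution, up to a factor of modulus q^h, into the extension of g at (ξ, -(4t)⁻¹), to which
`sum_norm_pow_four_le` applies. -/
lemma sum_norm_pow_four_surfaceKernel_le (hq : Fintype.card F % 4 = 3) (hχ : χ ≠ 1)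
    {h : ℕ} (hh : Odd h) (hι : Fintype.card ι = 2 * h) (E : Finset (ι → F)) (g : (ι → F) → ℂ)
    (hg : ∀ y, ‖g y‖ ≤ 1) :
    ∑ t ∈ Finset.univ.erase (0 : F), ∑ y : ι → F,
      ‖∑ z ∈ E, g z * surfaceKernel χ (y - z) t‖ ^ 4 ≤
      (Fintype.card F : ℝ) ^ (6 * h + 1) * rightAngleCount E := by
  have h2 := two_ne_zero_of_card hq
  have h4 := four_ne_zero_of_card hq
  set q := Fintype.card F
  have h1 : ∀ t ∈ Finset.univ.erase (0 : F), ∑ y : ι → F,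
      ‖∑ z ∈ E, g z * surfaceKernel χ (y - z) t‖ ^ 4 =
      (q : ℝ) ^ (4 * h) * ∑ ξ : ι → F,
        ‖∑ z ∈ E, g z * χ (z ⬝ᵥ ξ + -(4 * t)⁻¹ * (z ⬝ᵥ z))‖ ^ 4 := by
    intro t ht
    have ht0 : t ≠ 0 := Finset.ne_of_mem_erase ht
    have hc : (2 * t) ≠ 0 := mul_ne_zero h2 ht0
    rw [← Equiv.sum_comp (MulAction.toPerm (Units.mk0 _ hc)), Finset.mul_sum]
    refine Finset.sum_congr rfl fun ξ _ => ?_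
    have h3 : ∑ z ∈ E, g z * surfaceKernel χ (MulAction.toPerm (Units.mk0 _ hc) ξ - z) t =
        (-(q : ℂ) ^ h * χ (-(t * (ξ ⬝ᵥ ξ)))) *
          ∑ z ∈ E, g z * χ (z ⬝ᵥ ξ + -(4 * t)⁻¹ * (z ⬝ᵥ z)) := by
      rw [Finset.mul_sum]
      refine Finset.sum_congr rfl fun z _ => ?_
      rw [surfaceKernel, sum_addChar_dotProduct_add_self hq hχ hh hι ht0]
      have : -(4 * t)⁻¹ * ((MulAction.toPerm (Units.mk0 _ hc) ξ - z) ⬝ᵥ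
          (MulAction.toPerm (Units.mk0 _ hc) ξ - z)) =
          -(t * (ξ ⬝ᵥ ξ)) + (z ⬝ᵥ ξ + -(4 * t)⁻¹ * (z ⬝ᵥ z)) := by
        simp only [MulAction.toPerm_apply, Units.smul_mk0, sub_dotProduct, dotProduct_sub,
          smul_dotProduct, dotProduct_smul, smul_eq_mul, dotProduct_comm ξ z]
        field_simp
        ring
      rw [this, AddChar.map_add_eq_mul]
      ring
    rw [h3, norm_mul, mul_pow, norm_mul]
    simp only [norm_neg, norm_pow, Complex.norm_natCast, AddChar.norm_apply, mul_one]
    rw [← pow_mul, mul_comm h 4]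
  rw [Finset.sum_congr rfl h1, ← Finset.mul_sum,
    sum_neg_inv_four_mul h4 (fun τ => ∑ ξ : ι → F,
        ‖∑ z ∈ E, g z * χ (z ⬝ᵥ ξ + τ * (z ⬝ᵥ z))‖ ^ 4)]
  calc _ ≤ (q : ℝ) ^ (4 * h) * ∑ τ : F, ∑ ξ : ι → F,
        ‖∑ z ∈ E, g z * χ (z ⬝ᵥ ξ + τ * (z ⬝ᵥ z))‖ ^ 4 := by
        gcongr
        exact Finset.subset_univ _
    _ ≤ (q : ℝ) ^ (4 * h) * ((q : ℝ) ^ (2 * h + 1) * rightAngleCount E) := by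
        gcongr
        rw [Finset.sum_comm, ← Fintype.sum_prod_type', ← hι]
        exact sum_norm_pow_four_le h2 hχ E g hg
    _ = _ := by ring

/-- The horizontal slice of a set at height `b`. -/
def slice (G : Finset ((ι → F) × F)) (b : F) : Finset (ι → F) :=
  Finset.univ.filter fun y => (y, b) ∈ G

lemma sum_slice {R : Type*} [AddCommMonoid R] (G : Finset ((ι → F) × F))
    (f : (ι → F) × F → R) : ∑ b, ∑ y ∈ slice G b, f (y, b) = ∑ m ∈ G, f m := by
  simp_rw [slice, Finset.sum_filter]
  rw [Finset.sum_comm, ← Fintype.sum_prod_type' (fun y b => if (y, b) ∈ G then f (y, b) else 0),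
    ← Finset.sum_filter]
  simp

lemma sum_card_slice (G : Finset ((ι → F) × F)) : ∑ b, ((slice G b).card : ℝ) = G.card := by
  simp_rw [Finset.card_eq_sum_ones]
  push_cast
  exact sum_slice G (fun _ => (1 : ℝ))

/-- The Fourier transform of a function on `G`, at the point of the paraboloid above `p`. -/
def restriction (χ : AddChar F ℂ) (G : Finset ((ι → F) × F)) (g : (ι → F) × F → ℂ)
    (p : ι → F) : ℂ :=
  ∑ m ∈ G, g m * χ (p ⬝ᵥ m.1 + m.2 * (p ⬝ᵥ p))

lemma sum_norm_sq_restriction_eq (G : Finset ((ι → F) × F)) (g : (ι → F) × F → ℂ) :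
    ((∑ p, ‖restriction χ G g p‖ ^ 2 : ℝ) : ℂ) =
      ∑ m ∈ G, ∑ m' ∈ G, g m * conj (g m') * surfaceKernel χ (m.1 - m'.1) (m.2 - m'.2) := by
  push_cast
  simp_rw [← Complex.mul_conj', restriction, map_sum, map_mul, Finset.sum_mul_sum, surfaceKernel,
    Finset.mul_sum]
  rw [Finset.sum_comm]
  refine Finset.sum_congr rfl fun m _ => ?_
  rw [Finset.sum_comm]
  refine Finset.sum_congr rfl fun m' _ => Finset.sum_congr rfl fun p _ => ?_
  rw [mul_mul_mul_comm, addChar_mul_conj, dotProduct_sub]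
  congr 2
  ring

/-- In the TT* expansion the kernel at height 0 is a point mass, so the slice containing m
contributes only its diagonal term. The other slices are kept apart for the two later estimates. -/
lemma sum_norm_sq_restriction_le (hχ : χ ≠ 1) (G : Finset ((ι → F) × F)) (g : (ι → F) × F → ℂ)
    (hg : ∀ m, ‖g m‖ ≤ 1) :
    ∑ p, ‖restriction χ G g p‖ ^ 2 ≤
      (Fintype.card F : ℝ) ^ Fintype.card ι * G.card +
      ∑ m ∈ G, ∑ b ∈ Finset.univ.erase m.2,
        ‖∑ y ∈ slice G b, conj (g (y, b)) * surfaceKernel χ (m.1 - y) (m.2 - b)‖ := by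
  have hpos : (0 : ℝ) ≤ ∑ p, ‖restriction χ G g p‖ ^ 2 := Finset.sum_nonneg fun _ _ => sq_nonneg _
  rw [← Real.norm_of_nonneg hpos, ← Complex.norm_real, sum_norm_sq_restriction_eq]
  refine (norm_sum_le _ _).trans ?_
  rw [Finset.card_eq_sum_ones, Nat.cast_sum, Finset.mul_sum, ← Finset.sum_add_distrib]
  refine Finset.sum_le_sum fun m hm => ?_
  simp_rw [mul_assoc, ← Finset.mul_sum]
  rw [norm_mul]
  refine (mul_le_of_le_one_left (norm_nonneg _) (hg m)).trans ?_
  rw [← sum_slice, ← Finset.add_sum_erase _ _ (Finset.mem_univ m.2)]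
  refine (norm_add_le _ _).trans (add_le_add ?_ (norm_sum_le _ _))
  simp_rw [sub_self, surfaceKernel_zero hχ, sub_eq_zero, mul_ite, mul_zero]
  rw [Finset.sum_ite_eq, Nat.cast_one, mul_one]
  split_ifs
  · rw [norm_mul, RCLike.norm_conj, norm_pow, Complex.norm_natCast]
    exact mul_le_of_le_one_left (by positivity) (hg _)
  · rw [norm_zero]; positivity

/-- The `L ^ 2` restriction bound given by the decay of the Fourier transform of the surface
measure. -/
lemma sum_norm_sq_restriction_le_of_decay (hq : Fintype.card F % 4 = 3) (hχ : χ ≠ 1)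
    {h : ℕ} (hh : Odd h) (hι : Fintype.card ι = 2 * h)
    (G : Finset ((ι → F) × F)) (g : (ι → F) × F → ℂ) (hg : ∀ m, ‖g m‖ ≤ 1) :
    ∑ p, ‖restriction χ G g p‖ ^ 2 ≤
      (Fintype.card F : ℝ) ^ (2 * h) * G.card + (Fintype.card F : ℝ) ^ h * (G.card : ℝ) ^ 2 := by
  rw [← hι]
  refine (sum_norm_sq_restriction_le hχ G g hg).trans ?_
  refine add_le_add_right ?_ _
  calc _ ≤ ∑ m ∈ G, (Fintype.card F : ℝ) ^ h * G.card := by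
        refine Finset.sum_le_sum fun m _ => ?_
        calc _ ≤ ∑ b ∈ Finset.univ.erase m.2,
              (Fintype.card F : ℝ) ^ h * (slice G b).card := by
              refine Finset.sum_le_sum fun b hb => (norm_sum_le _ _).trans ?_
              rw [mul_comm, ← nsmul_eq_mul, ← Finset.sum_const]
              refine Finset.sum_le_sum fun y _ => ?_
              rw [norm_mul, RCLike.norm_conj, norm_surfaceKernel hq hχ hh hι _
                (sub_ne_zero.mpr (Finset.ne_of_mem_erase hb).symm)]
              exact mul_le_of_le_one_left (by positivity) (hg _)
          _ ≤ ∑ b, (Fintype.card F : ℝ) ^ h * (slice G b).card :=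
              Finset.sum_le_sum_of_subset_of_nonneg (Finset.subset_univ _)
                fun _ _ _ => by positivity
          _ = _ := by rw [← Finset.mul_sum, sum_card_slice]
    _ = _ := by rw [Finset.sum_const, nsmul_eq_mul]; ring

lemma sum_le_card_rpow_mul {J : Type*} (s : Finset J) (f : J → ℝ) (hf : ∀ j ∈ s, 0 ≤ f j) :
    ∑ j ∈ s, f j ≤ (s.card : ℝ) ^ (3 / 4 : ℝ) * (∑ j ∈ s, f j ^ 4) ^ (1 / 4 : ℝ) := by
  have := Real.inner_le_Lp_mul_Lq_of_nonneg s (f := fun _ => 1) (g := f) (p := 4 / 3) (q := 4)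
    (Real.holderConjugate_iff.mpr ⟨by norm_num, by norm_num⟩) (fun _ _ => zero_le_one) hf
  simp only [one_mul, Real.one_rpow, Finset.sum_const, nsmul_eq_mul, mul_one] at this
  refine this.trans (le_of_eq ?_)
  norm_num

/-- The `L ^ 2` restriction bound in terms of the right angles in the horizontal slices. -/
lemma sum_norm_sq_restriction_le_of_rightAngleCount (hq : Fintype.card F % 4 = 3) (hχ : χ ≠ 1)
    {h : ℕ} (hh : Odd h) (hι : Fintype.card ι = 2 * h)
    (G : Finset ((ι → F) × F)) (g : (ι → F) × F → ℂ) (hg : ∀ m, ‖g m‖ ≤ 1) :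
    ∑ p, ‖restriction χ G g p‖ ^ 2 ≤
      (Fintype.card F : ℝ) ^ (2 * h) * G.card + (G.card : ℝ) ^ (3 / 4 : ℝ) *
        ∑ b, ((Fintype.card F : ℝ) ^ (6 * h + 1) * rightAngleCount (slice G b)) ^ (1 / 4 : ℝ) := by
  rw [← hι]
  refine (sum_norm_sq_restriction_le hχ G g hg).trans ?_
  refine add_le_add_right ?_ _
  set H : F → (ι → F) × F → ℝ := fun b m =>
    ‖∑ y ∈ slice G b, conj (g (y, b)) * surfaceKernel χ (m.1 - y) (m.2 - b)‖
  -- Removing the dependence of the index set on m allows the slice b to be fixed first, with Hölder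
  -- then applied over m ∈ G.
  have h1 : ∀ m : (ι → F) × F, ∑ b ∈ Finset.univ.erase m.2, H b m =
      ∑ b, if b ≠ m.2 then H b m else 0 := fun m => by
    rw [← Finset.sum_filter, Finset.filter_ne']
  refine (le_of_eq (Finset.sum_congr rfl fun m _ => h1 m)).trans ?_
  rw [Finset.sum_comm, Finset.mul_sum]
  refine Finset.sum_le_sum fun b _ => ?_
  refine (sum_le_card_rpow_mul G _ fun m _ => ?_).trans ?_
  · split_ifs
    exacts [norm_nonneg _, le_rfl]
  gcongr
  calc _ ≤ ∑ m : (ι → F) × F, (if b ≠ m.2 then H b m else 0) ^ 4 :=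
        Finset.sum_le_sum_of_subset_of_nonneg (Finset.subset_univ _) fun _ _ _ => by positivity
    _ = ∑ t ∈ Finset.univ.erase (0 : F), ∑ y : ι → F,
          ‖∑ z ∈ slice G b, conj (g (z, b)) * surfaceKernel χ (y - z) t‖ ^ 4 := by
        rw [Fintype.sum_prod_type, Finset.sum_comm, ← Equiv.sum_comp (Equiv.addRight b),
          ← Finset.filter_ne' Finset.univ (0 : F), Finset.sum_filter]
        refine Finset.sum_congr rfl fun t _ => ?_
        by_cases ht : t = 0
        · simp [ht]
        · simp [ht, H]
    _ ≤ _ := sum_norm_pow_four_surfaceKernel_le hq hχ hh hι _ _ fun y => by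
        rw [RCLike.norm_conj]; exact hg _

end Restriction

/-! ### Size of the level sets of the extension, by duality. -/

section LevelSets

variable {F : Type*} [Field F] [Fintype F] [DecidableEq F] {χ : AddChar F ℂ}
variable {ι : Type*} [Fintype ι] [DecidableEq ι]

/-- Here N is a number of right angles in a set of size e. The three terms are the expected value
e³/q and the two parts of the variance, separated by subadditivity of the fourth root. -/
lemma rpow_quarter_le_of_sq_le {q e N : ℝ} {h : ℕ} (hq : 0 < q) (he : 0 ≤ e) (hN : 0 ≤ N)
    (H : (q * N - e ^ 3) ^ 2 ≤ e ^ 2 * (q ^ (2 * h) * (q * (2 * e ^ 2 + q ^ h * e)))) :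
    (q ^ (6 * h + 1) * N) ^ (1 / 4 : ℝ) ≤
      q ^ (6 * h / 4 : ℝ) * e ^ (3 / 4 : ℝ) + 2 * q ^ ((14 * h + 1) / 8 : ℝ) * e ^ (1 / 2 : ℝ) +
        q ^ ((15 * h + 1) / 8 : ℝ) * e ^ (3 / 8 : ℝ) := by
  set A : ℝ := 2 * q ^ ((2 * h + 1) / 2 : ℝ) * e ^ 2 with hA
  set B : ℝ := q ^ ((3 * h + 1) / 2 : ℝ) * e ^ (3 / 2 : ℝ) with hB
  have hA0 : 0 ≤ A := by positivity
  have hB0 : 0 ≤ B := by positivity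
  have hA2 : A ^ 2 = 4 * q ^ (2 * h + 1) * e ^ 4 := by
    rw [hA, mul_pow, mul_pow, ← Real.rpow_natCast (q ^ _), ← Real.rpow_mul hq.le,
      ← Real.rpow_natCast q]
    push_cast
    ring_nf
  have hB2 : B ^ 2 = q ^ (3 * h + 1) * e ^ 3 := by
    rw [hB, mul_pow, ← Real.rpow_natCast (q ^ _), ← Real.rpow_mul hq.le,
      ← Real.rpow_natCast (e ^ _), ← Real.rpow_mul he, ← Real.rpow_natCast q,
      ← Real.rpow_natCast e]
    push_cast
    ring_nf
  have h1 : q * N - e ^ 3 ≤ A + B := by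
    refine (le_abs_self _).trans (abs_le_of_sq_le_sq ?_ (by positivity))
    have h3 : 0 ≤ q ^ (2 * h + 1) * e ^ 4 := by positivity
    calc _ ≤ _ := H
      _ = 2 * (q ^ (2 * h + 1) * e ^ 4) + q ^ (3 * h + 1) * e ^ 3 := by ring
      _ ≤ A ^ 2 + B ^ 2 := by rw [hA2, hB2]; linarith
      _ ≤ (A + B) ^ 2 := by nlinarith [mul_nonneg hA0 hB0]
  have h2 : q ^ (6 * h + 1) * N ≤ q ^ (6 * h) * e ^ 3 + q ^ (6 * h) * A + q ^ (6 * h) * B := by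
    have : 0 < q ^ (6 * h) := by positivity
    rw [pow_succ, mul_assoc, ← mul_add, ← mul_add]
    refine mul_le_mul_of_nonneg_left ?_ this.le
    linarith
  have h14 : (0 : ℝ) ≤ 1 / 4 := by norm_num
  have h14' : (1 / 4 : ℝ) ≤ 1 := by norm_num
  calc _ ≤ (q ^ (6 * h) * e ^ 3 + q ^ (6 * h) * A + q ^ (6 * h) * B) ^ (1 / 4 : ℝ) := by gcongr
    _ ≤ (q ^ (6 * h) * e ^ 3) ^ (1 / 4 : ℝ) + (q ^ (6 * h) * A) ^ (1 / 4 : ℝ) +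
          (q ^ (6 * h) * B) ^ (1 / 4 : ℝ) :=
        (Real.rpow_add_le_add_rpow (by positivity) (by positivity) h14 h14').trans
          (add_le_add_left
            (Real.rpow_add_le_add_rpow (by positivity) (by positivity) h14 h14') _)
    _ ≤ _ := by
        have hqh : (q ^ (6 * h)) ^ (1 / 4 : ℝ) = q ^ (6 * h / 4 : ℝ) := by
          rw [← Real.rpow_natCast q, ← Real.rpow_mul hq.le]
          push_cast
          ring_nf
        rw [Real.mul_rpow (by positivity) (by positivity),
          Real.mul_rpow (by positivity) hA0, Real.mul_rpow (by positivity) hB0, hqh]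
        refine add_le_add (add_le_add ?_ ?_) ?_
        · rw [← Real.rpow_natCast e, ← Real.rpow_mul he]
          norm_num
        · rw [hA, Real.mul_rpow (by positivity) (by positivity),
            Real.mul_rpow (by positivity) (by positivity), ← Real.rpow_mul hq.le,
            ← Real.rpow_natCast e, ← Real.rpow_mul he]
          calc _ = (2 : ℝ) ^ (1 / 4 : ℝ) *
                (q ^ (6 * h / 4 : ℝ) * q ^ ((2 * h + 1) / 2 * (1 / 4) : ℝ)) *
                e ^ (((2 : ℕ) : ℝ) * (1 / 4)) := by ring
            _ ≤ (2 : ℝ) ^ (1 : ℝ) *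
                (q ^ (6 * h / 4 : ℝ) * q ^ ((2 * h + 1) / 2 * (1 / 4) : ℝ)) *
                e ^ (((2 : ℕ) : ℝ) * (1 / 4)) := by
                  gcongr
                  norm_num
            _ = _ := by
                rw [← Real.rpow_add hq, Real.rpow_one]
                push_cast
                ring_nf
        · rw [hB, Real.mul_rpow (by positivity) (by positivity), ← Real.rpow_mul hq.le,
            ← Real.rpow_mul he, ← mul_assoc, ← Real.rpow_add hq]
          apply le_of_eq
          ring_nf

lemma sum_rpow_card_slice_le (G : Finset ((ι → F) × F)) {θ : ℝ} (h0 : 0 < θ) (h1 : θ ≤ 1) :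
    ∑ b, ((slice G b).card : ℝ) ^ θ ≤ (Fintype.card F : ℝ) ^ (1 - θ) * (G.card : ℝ) ^ θ := by
  have := Real.inner_le_weight_mul_Lp_of_nonneg (Finset.univ : Finset F) (p := θ⁻¹)
    ((one_le_inv₀ h0).mpr h1) (fun _ => 1) (fun b => ((slice G b).card : ℝ) ^ θ)
    (fun _ => zero_le_one) (fun _ => by positivity)
  simp only [one_mul, inv_inv, Finset.sum_const, nsmul_eq_mul, mul_one, Finset.card_univ] at this
  refine this.trans (le_of_eq ?_)
  simp_rw [← Real.rpow_mul (Nat.cast_nonneg _), mul_inv_cancel₀ h0.ne', Real.rpow_one,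
    sum_card_slice]

/-- The `L ^ 2` restriction bound given by the additive energy of the horizontal slices. -/
lemma sum_norm_sq_restriction_le_of_energy (hq : Fintype.card F % 4 = 3) (hχ : χ ≠ 1)
    {h : ℕ} (hh : Odd h) (hι : Fintype.card ι = 2 * h)
    (G : Finset ((ι → F) × F)) (g : (ι → F) × F → ℂ) (hg : ∀ m, ‖g m‖ ≤ 1) :
    ∑ p, ‖restriction χ G g p‖ ^ 2 ≤
      (Fintype.card F : ℝ) ^ (2 * h) * G.card +
        ((Fintype.card F : ℝ) ^ ((6 * h + 1) / 4 : ℝ) * (G.card : ℝ) ^ (3 / 2 : ℝ) +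
        2 * (Fintype.card F : ℝ) ^ ((14 * h + 5) / 8 : ℝ) * (G.card : ℝ) ^ (5 / 4 : ℝ) +
        (Fintype.card F : ℝ) ^ ((15 * h + 6) / 8 : ℝ) * (G.card : ℝ) ^ (9 / 8 : ℝ)) := by
  refine (sum_norm_sq_restriction_le_of_rightAngleCount hq hχ hh hι G g hg).trans ?_
  refine add_le_add_right ?_ _
  set q : ℝ := (Fintype.card F : ℝ) with hqdef
  have hq0 : 0 < q := by rw [hqdef]; exact_mod_cast Fintype.card_pos
  have hX : (0 : ℝ) ≤ G.card := Nat.cast_nonneg _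
  -- G may be empty, so exponents of its cardinality are added through `Real.rpow_add'`, which needs
  -- a nonzero total exponent.
  have hcomb : ∀ {a b c d e f : ℝ}, b + c = d → 0 < a + e → a + e = f →
      (G.card : ℝ) ^ a * (q ^ b * (q ^ c * (G.card : ℝ) ^ e)) = q ^ d * (G.card : ℝ) ^ f := by
    intro a b c d e f h1 h2 h3
    rw [← h1, ← h3, Real.rpow_add hq0, Real.rpow_add' hX h2.ne']
    ring
  calc _ ≤ (G.card : ℝ) ^ (3 / 4 : ℝ) * ∑ b,
        (q ^ (6 * h / 4 : ℝ) * ((slice G b).card : ℝ) ^ (3 / 4 : ℝ) +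
        2 * q ^ ((14 * h + 1) / 8 : ℝ) * ((slice G b).card : ℝ) ^ (1 / 2 : ℝ) +
        q ^ ((15 * h + 1) / 8 : ℝ) * ((slice G b).card : ℝ) ^ (3 / 8 : ℝ)) := by
        gcongr with b _
        exact rpow_quarter_le_of_sq_le hq0 (Nat.cast_nonneg _) (Nat.cast_nonneg _)
          (sq_card_mul_rightAngleCount_sub_le hq hχ hh hι _)
    _ ≤ (G.card : ℝ) ^ (3 / 4 : ℝ) *
        (q ^ (6 * h / 4 : ℝ) * (q ^ (1 - 3 / 4 : ℝ) * (G.card : ℝ) ^ (3 / 4 : ℝ)) +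
        2 * q ^ ((14 * h + 1) / 8 : ℝ) * (q ^ (1 - 1 / 2 : ℝ) * (G.card : ℝ) ^ (1 / 2 : ℝ)) +
        q ^ ((15 * h + 1) / 8 : ℝ) * (q ^ (1 - 3 / 8 : ℝ) * (G.card : ℝ) ^ (3 / 8 : ℝ))) := by
        rw [Finset.sum_add_distrib, Finset.sum_add_distrib, ← Finset.mul_sum, ← Finset.mul_sum,
          ← Finset.mul_sum]
        gcongr
        · exact sum_rpow_card_slice_le G (by norm_num) (by norm_num)
        · exact sum_rpow_card_slice_le G (by norm_num) (by norm_num)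
        · exact sum_rpow_card_slice_le G (by norm_num) (by norm_num)
    _ = _ := by
        rw [mul_add, mul_add, mul_assoc 2, mul_left_comm _ 2,
          hcomb (d := (6 * h + 1) / 4) (f := 3 / 2) (by ring) (by norm_num) (by norm_num),
          hcomb (d := (14 * h + 5) / 8) (f := 5 / 4) (by ring) (by norm_num) (by norm_num),
          hcomb (d := (15 * h + 6) / 8) (f := 9 / 8) (by ring) (by norm_num) (by norm_num)]
        ring

/-- The extension operator of the paraboloid in graph coordinates. -/
def graphExtension (χ : AddChar F ℂ) (φ : (ι → F) → ℂ) (m : (ι → F) × F) : ℂ :=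
  ((Fintype.card F : ℂ) ^ Fintype.card ι)⁻¹ * ∑ p, φ p * χ (p ⬝ᵥ m.1 + m.2 * (p ⬝ᵥ p))

lemma sum_norm_sq_graphExtension (hχ : χ ≠ 1) (φ : (ι → F) → ℂ) :
    (Fintype.card F : ℝ) ^ Fintype.card ι * ∑ m, ‖graphExtension χ φ m‖ ^ 2 =
      Fintype.card F * ∑ p, ‖φ p‖ ^ 2 := by
  have hq0 : (Fintype.card F : ℝ) ≠ 0 := by exact_mod_cast Fintype.card_ne_zero
  have hP := sum_norm_sq_sum_mul (M := (ι → F) × F) Finset.univ φ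
    (fun m p => χ (p ⬝ᵥ m.1 + m.2 * (p ⬝ᵥ p))) (fun p p' => p = p')
    ((Fintype.card F : ℂ) ^ Fintype.card ι * Fintype.card F) (by
      intro p _ p' _
      rw [Fintype.sum_prod_type]
      have : ∀ (ξ : ι → F) (τ : F),
          χ (p ⬝ᵥ ξ + τ * (p ⬝ᵥ p)) * conj (χ (p' ⬝ᵥ ξ + τ * (p' ⬝ᵥ p'))) =
          χ ((p - p') ⬝ᵥ ξ) * χ ((p ⬝ᵥ p - p' ⬝ᵥ p') * τ) := by
        intro ξ τ
        rw [addChar_mul_conj, ← AddChar.map_add_eq_mul, sub_dotProduct]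
        congr 1
        ring
      simp_rw [this, ← Finset.mul_sum, ← Finset.sum_mul, sum_addChar_dotProduct hχ,
        sum_addChar_mul hχ, sub_eq_zero]
      by_cases h : p = p' <;> simp [h])
  simp only [Finset.sum_ite_eq, Finset.mem_univ, if_true, Complex.mul_conj'] at hP
  have hP' : ∑ m : (ι → F) × F, ‖∑ p, φ p * χ (p ⬝ᵥ m.1 + m.2 * (p ⬝ᵥ p))‖ ^ 2 =
      (Fintype.card F : ℝ) ^ Fintype.card ι * Fintype.card F * ∑ p, ‖φ p‖ ^ 2 := by
    exact_mod_cast hP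
  simp_rw [graphExtension, norm_mul, mul_pow, ← Finset.mul_sum, hP', norm_inv, norm_pow,
    Complex.norm_natCast]
  field_simp

/-- Cauchy–Schwarz; it stops the dyadic decomposition at height 1. -/
lemma norm_graphExtension_le_one {φ : (ι → F) → ℂ}
    (hφ : ∑ p, ‖φ p‖ ^ 2 ≤ (Fintype.card F : ℝ) ^ Fintype.card ι) (m : (ι → F) × F) :
    ‖graphExtension χ φ m‖ ≤ 1 := by
  have hq0 : (0 : ℝ) < (Fintype.card F : ℝ) ^ Fintype.card ι :=
    pow_pos (by exact_mod_cast Fintype.card_pos) _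
  rw [graphExtension, norm_mul, norm_inv, norm_pow, Complex.norm_natCast, inv_mul_le_one₀ hq0]
  refine (norm_sum_le _ _).trans ?_
  simp_rw [norm_mul, AddChar.norm_apply, mul_one]
  refine le_of_sq_le_sq ?_ hq0.le
  refine (sq_sum_le_card_mul_sum_sq (s := Finset.univ) (f := fun p => ‖φ p‖)).trans ?_
  rw [Finset.card_univ, Fintype.card_fun, sq]
  push_cast
  gcongr

/-- Level sets of the extension are controlled by the dual restriction inequality. -/
lemma exists_sq_mul_sq_card_le {φ : (ι → F) → ℂ}
    (hφ : ∑ p, ‖φ p‖ ^ 2 ≤ (Fintype.card F : ℝ) ^ Fintype.card ι) {t : ℝ} (ht : 0 < t)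
    (G : Finset ((ι → F) × F)) (hG : ∀ m ∈ G, t ≤ ‖graphExtension χ φ m‖) :
    ∃ g : (ι → F) × F → ℂ, (∀ m, ‖g m‖ ≤ 1) ∧
      (Fintype.card F : ℝ) ^ Fintype.card ι * (t ^ 2 * (G.card : ℝ) ^ 2) ≤
        ∑ p, ‖restriction χ G g p‖ ^ 2 := by
  have hq0 : (0 : ℝ) < (Fintype.card F : ℝ) ^ Fintype.card ι :=
    pow_pos (by exact_mod_cast Fintype.card_pos) _
  set u := graphExtension χ φ
  -- The witness is the conjugate phase of u, with value 0 where u vanishes. Pairing it with u on G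
  -- gives the sum of |u|, and moving it to the paraboloid gives its restriction.
  refine ⟨fun m => conj (u m) / ‖u m‖, fun m => ?_, ?_⟩
  · rw [norm_div, RCLike.norm_conj, Complex.norm_real, norm_norm]
    exact div_self_le_one _
  set g : (ι → F) × F → ℂ := fun m => conj (u m) / ‖u m‖ with hg
  have h1 : ∀ m ∈ G, g m * u m = ‖u m‖ := by
    intro m hm
    have : (‖u m‖ : ℂ) ≠ 0 := by exact_mod_cast (ht.trans_le (hG m hm)).ne'
    rw [hg, div_mul_eq_mul_div, Complex.conj_mul']
    field_simp
  have h2 : ((∑ m ∈ G, ‖u m‖ : ℝ) : ℂ) =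
      ((Fintype.card F : ℂ) ^ Fintype.card ι)⁻¹ * ∑ p, φ p * restriction χ G g p := by
    push_cast
    rw [Finset.sum_congr rfl fun m hm => (h1 m hm).symm]
    simp_rw [u, graphExtension, restriction, Finset.mul_sum]
    rw [Finset.sum_comm]
    refine Finset.sum_congr rfl fun p _ => Finset.sum_congr rfl fun m _ => ?_
    ring
  have h3 : (Fintype.card F : ℝ) ^ Fintype.card ι * (t * G.card) ≤
      ∑ p, ‖φ p‖ * ‖restriction χ G g p‖ := by
    have h4 : t * G.card ≤ ∑ m ∈ G, ‖u m‖ := by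
      rw [mul_comm, ← nsmul_eq_mul, ← Finset.sum_const]
      exact Finset.sum_le_sum hG
    have h5 : (0 : ℝ) ≤ ∑ m ∈ G, ‖u m‖ := Finset.sum_nonneg fun _ _ => norm_nonneg _
    have h6 : ∑ m ∈ G, ‖u m‖ ≤ ((Fintype.card F : ℝ) ^ Fintype.card ι)⁻¹ *
        ∑ p, ‖φ p‖ * ‖restriction χ G g p‖ := by
      rw [← Real.norm_of_nonneg h5, ← Complex.norm_real, h2, norm_mul, norm_inv, norm_pow,
        Complex.norm_natCast]
      gcongr
      exact (norm_sum_le _ _).trans (le_of_eq (by simp_rw [norm_mul]))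
    have := h4.trans h6
    rwa [le_inv_mul_iff₀ hq0] at this
  have h7 := (pow_le_pow_left₀ (by positivity) h3 2).trans
    (Finset.sum_mul_sq_le_sq_mul_sq Finset.univ (fun p => ‖φ p‖) fun p => ‖restriction χ G g p‖)
  have h8 : 0 ≤ ∑ p, ‖restriction χ G g p‖ ^ 2 := Finset.sum_nonneg fun _ _ => sq_nonneg _
  refine le_of_mul_le_mul_left ?_ hq0
  calc _ = ((Fintype.card F : ℝ) ^ Fintype.card ι * (t * G.card)) ^ 2 := by ring
    _ ≤ _ := h7.trans (mul_le_mul_of_nonneg_right hφ h8)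

/-- The two bounds for the size of a level set `{t ≤ |(f dσ)^∨|}`. -/
lemma sq_mul_sq_card_le (hq : Fintype.card F % 4 = 3) (hχ : χ ≠ 1)
    {h : ℕ} (hh : Odd h) (hι : Fintype.card ι = 2 * h) {φ : (ι → F) → ℂ}
    (hφ : ∑ p, ‖φ p‖ ^ 2 ≤ (Fintype.card F : ℝ) ^ Fintype.card ι) {t : ℝ} (ht : 0 < t)
    (G : Finset ((ι → F) × F)) (hG : ∀ m ∈ G, t ≤ ‖graphExtension χ φ m‖) :
    t ^ 2 * (G.card : ℝ) ^ 2 ≤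
        G.card + (Fintype.card F : ℝ) ^ (-h : ℝ) * (G.card : ℝ) ^ 2 ∧
      t ^ 2 * (G.card : ℝ) ^ 2 ≤ G.card +
        ((Fintype.card F : ℝ) ^ ((1 - 2 * h) / 4 : ℝ) * (G.card : ℝ) ^ (3 / 2 : ℝ) +
        2 * (Fintype.card F : ℝ) ^ ((5 - 2 * h) / 8 : ℝ) * (G.card : ℝ) ^ (5 / 4 : ℝ) +
        (Fintype.card F : ℝ) ^ ((6 - h) / 8 : ℝ) * (G.card : ℝ) ^ (9 / 8 : ℝ)) := by
  have hq0 : (0 : ℝ) < Fintype.card F := by exact_mod_cast Fintype.card_pos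
  obtain ⟨g, hg, hle⟩ := exists_sq_mul_sq_card_le (χ := χ) hφ ht G hG
  have h1 := hle.trans (sum_norm_sq_restriction_le_of_decay hq hχ hh hι G g hg)
  have h2 := hle.trans (sum_norm_sq_restriction_le_of_energy hq hχ hh hι G g hg)
  rw [hι] at h1 h2
  have hpos : (0 : ℝ) < (Fintype.card F : ℝ) ^ (2 * h) := by positivity
  have hcomb : ∀ a b : ℝ, 2 * h + a = b →
      (Fintype.card F : ℝ) ^ b = (Fintype.card F : ℝ) ^ (2 * h) * (Fintype.card F : ℝ) ^ a := by
    intro a b hab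
    rw [← hab, Real.rpow_add hq0, ← Real.rpow_natCast _ (2 * h)]
    push_cast
    rfl
  rw [← Real.rpow_natCast _ h, hcomb (-h) (h : ℝ) (by ring)] at h1
  rw [hcomb ((1 - 2 * h) / 4) ((6 * h + 1) / 4) (by ring),
    hcomb ((5 - 2 * h) / 8) ((14 * h + 5) / 8) (by ring),
    hcomb ((6 - h) / 8) ((15 * h + 6) / 8) (by ring)] at h2
  constructor
  · refine le_of_mul_le_mul_left (h1.trans (le_of_eq ?_)) hpos
    ring
  · refine le_of_mul_le_mul_left (h2.trans (le_of_eq ?_)) hpos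
    ring

end LevelSets

/-! ### Exponent bookkeeping and dyadic summation. -/

section Dyadic

lemma le_of_sq_mul_sq_le {t X c q α β : ℝ} (ht : 0 < t) (hX : 0 < X) (hc : 0 < c) (hq : 0 < q)
    (hβ : 0 < β) (h : t ^ 2 * X ^ 2 ≤ c * q ^ α * X ^ (2 - β)) :
    X ≤ c ^ (1 / β) * q ^ (α / β) * t ^ (-(2 / β)) := by
  have h1 : X ^ β ≤ c * q ^ α * t ^ (-2 : ℝ) := by
    have h2 : X ^ 2 = X ^ (2 - β) * X ^ β := by
      rw [← Real.rpow_add hX, sub_add_cancel, Real.rpow_two]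
    have h3 : (0 : ℝ) < X ^ (2 - β) := by positivity
    rw [Real.rpow_neg ht.le, Real.rpow_two, ← div_eq_mul_inv, le_div_iff₀ (by positivity)]
    refine le_of_mul_le_mul_left ?_ h3
    calc _ = t ^ 2 * X ^ 2 := by rw [h2]; ring
      _ ≤ _ := h
      _ = _ := by ring
  calc X = (X ^ β) ^ (1 / β) := by
        rw [← Real.rpow_mul hX.le, mul_one_div_cancel hβ.ne', Real.rpow_one]
    _ ≤ (c * q ^ α * t ^ (-2 : ℝ)) ^ (1 / β) := by gcongr
    _ = _ := by
        rw [Real.mul_rpow (by positivity) (by positivity),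
          Real.mul_rpow (by positivity) (by positivity), ← Real.rpow_mul hq.le,
          ← Real.rpow_mul ht.le]
        ring_nf

lemma rpow_le_rpow_of_le_one {x a b : ℝ} (hx : 0 < x) (hx1 : x ≤ 1) (h : a ≤ b) :
    x ^ b ≤ x ^ a := Real.rpow_le_rpow_of_exponent_ge hx hx1 h

/-- The profile that bounds `t ^ r |{t ≤ |(f dσ)^∨|}|` between the thresholds `t₀` and `1`. -/
def levelProfile (ε t₀ T t : ℝ) : ℝ :=
  (t₀ / t) ^ ε + t ^ ε + if t ≤ T then (t / T) ^ ε else 0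

/-- For t > T the quadratic term of H1 is absorbed. For t ≤ T the largest term of H2 decides. The
X^(3/2) and X^(5/4) terms meet the scale t₀ = q^(-d/4) with equality of exponents; the X^(9/8) term
needs h ≥ 3 and changes monotonicity in t between h = 5 and h = 7. -/
lemma rpow_mul_le_levelProfile {q X t t₀ ε : ℝ} {h : ℕ} (h3 : 3 ≤ h) (hodd : Odd h) (hq : 1 ≤ q)
    (hX : 0 ≤ X) (ht₀ : t₀ = q ^ (-(2 * h + 1) / 4 : ℝ)) (ht : t₀ ≤ t) (ht1 : t ≤ 1)
    (hε : 0 < ε) (hεd : ε ≤ 4 / (2 * h + 1)) (hε' : ε ≤ 1 / 100)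
    (H1 : t ^ 2 * X ^ 2 ≤ X + q ^ (-h : ℝ) * X ^ 2)
    (H2 : t ^ 2 * X ^ 2 ≤ X + (q ^ ((1 - 2 * h) / 4 : ℝ) * X ^ (3 / 2 : ℝ) +
        2 * q ^ ((5 - 2 * h) / 8 : ℝ) * X ^ (5 / 4 : ℝ) +
        q ^ ((6 - h) / 8 : ℝ) * X ^ (9 / 8 : ℝ))) :
    t ^ (2 + 4 / (2 * h + 1) : ℝ) * X ≤
      64 * levelProfile ε t₀ (√2 * q ^ (-h / 2 : ℝ)) t := by
  have hq0 : 0 < q := one_pos.trans_le hq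
  have ht₀0 : 0 < t₀ := by rw [ht₀]; positivity
  have ht0 : 0 < t := ht₀0.trans_le ht
  set T : ℝ := √2 * q ^ (-h / 2 : ℝ) with hT
  have hT0 : 0 < T := by positivity
  have hd : (7 : ℝ) ≤ 2 * h + 1 := by
    have : (3 : ℝ) ≤ h := by exact_mod_cast h3
    linarith
  set d : ℝ := 2 * h + 1 with hddef
  have hd0 : 0 < d := by linarith
  have h4d : 4 / d ≤ 4 / 7 := by gcongr
  have hA : 0 ≤ (t₀ / t) ^ ε := by positivity
  have hB : 0 ≤ t ^ ε := by positivity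
  have hC : 0 ≤ if t ≤ T then (t / T) ^ ε else 0 := by split_ifs <;> positivity
  rw [levelProfile]
  rcases hX.eq_or_lt with rfl | hX
  · rw [mul_zero]; positivity
  -- A bound X ≲ t^(-2) leaves the factor t^(4/d), which is at most t^ε.
  have hsmall : ∀ c : ℝ, 0 ≤ c → c ≤ 64 → X ≤ c * t ^ (-2 : ℝ) →
      t ^ (2 + 4 / d) * X ≤ 64 * ((t₀ / t) ^ ε + t ^ ε + if t ≤ T then (t / T) ^ ε else 0) := by
    intro c hc0 hc hle
    calc t ^ (2 + 4 / d) * X ≤ t ^ (2 + 4 / d) * (c * t ^ (-2 : ℝ)) := by gcongr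
      _ = c * t ^ (4 / d) := by
          rw [mul_left_comm, ← Real.rpow_add ht0]
          ring_nf
      _ ≤ c * t ^ ε := by
          gcongr c * ?_
          exact rpow_le_rpow_of_le_one ht0 ht1 hεd
      _ ≤ 64 * t ^ ε := by gcongr
      _ ≤ _ := by linarith
  -- The condition on α says that q^α t^(-s) is at most (t₀/t)^s.
  have hratio : ∀ c s α : ℝ, 0 ≤ c → c ≤ 64 → ε ≤ s → α ≤ -(d / 4) * s →
      X ≤ c * q ^ α * t ^ (-(2 + 4 / d + s)) →
      t ^ (2 + 4 / d) * X ≤ 64 * ((t₀ / t) ^ ε + t ^ ε + if t ≤ T then (t / T) ^ ε else 0) := by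
    intro c s α hc0 hc hs hα hle
    calc t ^ (2 + 4 / d) * X ≤ t ^ (2 + 4 / d) * (c * q ^ α * t ^ (-(2 + 4 / d + s))) := by gcongr
      _ = c * q ^ α * t ^ (-s) := by
          rw [mul_left_comm, ← Real.rpow_add ht0]
          ring_nf
      _ ≤ c * q ^ (-(d / 4) * s) * t ^ (-s) := by gcongr
      _ = c * (t₀ / t) ^ s := by
          rw [ht₀, Real.div_rpow (by positivity) ht0.le, ← Real.rpow_mul hq0.le,
            Real.rpow_neg ht0.le]
          ring_nf
      _ ≤ c * (t₀ / t) ^ ε := by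
          gcongr c * ?_
          exact rpow_le_rpow_of_le_one (by positivity) ((div_le_one ht0).mpr ht) hs
      _ ≤ 64 * (t₀ / t) ^ ε := by gcongr
      _ ≤ _ := by linarith
  rcases lt_or_ge T t with hTt | htT
  · refine hsmall 2 (by norm_num) (by norm_num) ?_
    have h5 : q ^ (-h : ℝ) ≤ t ^ 2 / 2 := by
      have : T ^ 2 = 2 * q ^ (-h : ℝ) := by
        rw [hT, mul_pow, Real.sq_sqrt (by norm_num), ← Real.rpow_natCast (q ^ _),
          ← Real.rpow_mul hq0.le]
        push_cast
        ring_nf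
      have h6 : T ^ 2 ≤ t ^ 2 := by gcongr
      linarith
    have h6 : t ^ 2 * X ^ 2 ≤ X + t ^ 2 / 2 * X ^ 2 := H1.trans (by gcongr)
    rw [Real.rpow_neg ht0.le, Real.rpow_two, ← div_eq_mul_inv, le_div_iff₀ (by positivity)]
    refine le_of_mul_le_mul_left ?_ hX
    linarith
  have hcases : t ^ 2 * X ^ 2 ≤ 4 * X ∨
      t ^ 2 * X ^ 2 ≤ 4 * q ^ ((1 - 2 * h) / 4 : ℝ) * X ^ (2 - 1 / 2 : ℝ) ∨
      t ^ 2 * X ^ 2 ≤ 8 * q ^ ((5 - 2 * h) / 8 : ℝ) * X ^ (2 - 3 / 4 : ℝ) ∨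
      t ^ 2 * X ^ 2 ≤ 4 * q ^ ((6 - h) / 8 : ℝ) * X ^ (2 - 7 / 8 : ℝ) := by
    rw [show (2 - 1 / 2 : ℝ) = 3 / 2 by norm_num, show (2 - 3 / 4 : ℝ) = 5 / 4 by norm_num,
      show (2 - 7 / 8 : ℝ) = 9 / 8 by norm_num]
    by_contra! hcon
    linarith [hcon.1, hcon.2.1, hcon.2.2.1, hcon.2.2.2]
  rcases hcases with h5 | h5 | h5 | h5
  · refine hsmall 4 (by norm_num) (by norm_num) ?_
    rw [Real.rpow_neg ht0.le, Real.rpow_two, ← div_eq_mul_inv, le_div_iff₀ (by positivity)]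
    refine le_of_mul_le_mul_left ?_ hX
    linarith
  · have h6 := le_of_sq_mul_sq_le ht0 hX (by norm_num) hq0 (by norm_num) h5
    refine hratio (4 ^ (1 / (1 / 2) : ℝ)) (2 - 4 / d) ((1 - 2 * h) / 4 / (1 / 2))
      (by norm_num) (by norm_num) (by linarith) ?_ (h6.trans (le_of_eq ?_))
    · rw [mul_sub]
      have : -(d / 4) * (4 / d) = -1 := by field_simp
      rw [this, hddef]
      linarith
    · ring_nf
  · have h6 := le_of_sq_mul_sq_le ht0 hX (by norm_num) hq0 (by norm_num) h5
    refine hratio (8 ^ (1 / (3 / 4) : ℝ)) (2 / 3 - 4 / d) ((5 - 2 * h) / 8 / (3 / 4))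
      (by positivity) ?_ (by linarith) ?_ (h6.trans (le_of_eq ?_))
    · calc (8 : ℝ) ^ (1 / (3 / 4) : ℝ) ≤ 8 ^ (2 : ℝ) := by gcongr <;> norm_num
        _ ≤ 64 := by norm_num
    · rw [mul_sub]
      have : -(d / 4) * (4 / d) = -1 := by field_simp
      rw [this, hddef]
      linarith
    · ring_nf
  · have h6 := le_of_sq_mul_sq_le ht0 hX (by norm_num) hq0 (by norm_num) h5
    have h16 : (4 : ℝ) ^ (1 / (7 / 8) : ℝ) ≤ 16 := by
      calc (4 : ℝ) ^ (1 / (7 / 8) : ℝ) ≤ 4 ^ (2 : ℝ) := by gcongr <;> norm_num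
        _ ≤ 16 := by norm_num
    -- This term gives t^r X ≲ q^((6-h)/7) t^(4/d - 2/7). The exponent of t is negative for d ≥ 15,
    -- when t₀ is the reference scale, and positive for d ≤ 11, when T is. As h is odd, these are
    -- the only cases.
    rcases le_or_gt 7 h with h7 | h7
    · have h7' : (7 : ℝ) ≤ h := by exact_mod_cast h7
      have h15 : 4 / d ≤ 4 / 15 := by
        gcongr
        linarith
      refine hratio (4 ^ (1 / (7 / 8) : ℝ)) (2 / 7 - 4 / d) ((6 - h) / 8 / (7 / 8))
        (by positivity) (by linarith) (by linarith) ?_ (h6.trans (le_of_eq ?_))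
      · rw [mul_sub]
        have : -(d / 4) * (4 / d) = -1 := by field_simp
        rw [this, hddef]
        linarith
      · ring_nf
    · have h5' : (h : ℝ) ≤ 5 := by
        have : h ≤ 5 := by
          obtain ⟨k, hk⟩ := hodd
          omega
        exact_mod_cast this
      have h11 : 4 / 11 ≤ 4 / d := by
        gcongr
        linarith
      set s : ℝ := 4 / d - 2 / 7 with hs
      have hsε : ε ≤ s := by linarith
      have hs1 : s ≤ 1 := by linarith
      have hexp : (6 - h) / 8 / (7 / 8) ≤ (h / 2 : ℝ) * s := by
        rw [hs, mul_sub, ← sub_nonneg]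
        -- The margin (2h - 6)/(7d) vanishes at h = 3, so dimension 7 is critical here.
        have : (h / 2 * (4 / d) - h / 2 * (2 / 7) - (6 - h) / 8 / (7 / 8) : ℝ) =
            (2 * h - 6) / (7 * d) := by
          rw [hddef]
          field_simp
          ring
        rw [this]
        apply div_nonneg <;> linarith
      calc t ^ (2 + 4 / d) * X ≤ t ^ (2 + 4 / d) *
            (4 ^ (1 / (7 / 8) : ℝ) * q ^ ((6 - h) / 8 / (7 / 8) : ℝ) * t ^ (-(2 / (7 / 8)) : ℝ)) := by
            gcongr
        _ = 4 ^ (1 / (7 / 8) : ℝ) * q ^ ((6 - h) / 8 / (7 / 8) : ℝ) * t ^ s := by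
            rw [mul_left_comm, ← Real.rpow_add ht0, hs]
            ring_nf
        _ ≤ 16 * q ^ ((h / 2 : ℝ) * s) * t ^ s := by gcongr
        _ = 16 * (√2 ^ s * (t / T) ^ s) := by
            rw [hT, Real.div_rpow ht0.le (by positivity),
              Real.mul_rpow (by positivity) (by positivity), ← Real.rpow_mul hq0.le]
            have : q ^ (-h / 2 * s : ℝ) = (q ^ ((h / 2 : ℝ) * s))⁻¹ := by
              rw [← Real.rpow_neg hq0.le]
              ring_nf
            rw [this]
            field_simp
        _ ≤ 16 * (2 * (t / T) ^ ε) := by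
            gcongr 16 * (?_ * ?_)
            · calc √2 ^ s ≤ √2 ^ (1 : ℝ) := by
                    gcongr
                    exact Real.one_le_sqrt.mpr (by norm_num)
                _ ≤ 2 := by
                    rw [Real.rpow_one]
                    exact Real.sqrt_le_iff.mpr (by norm_num)
            · exact rpow_le_rpow_of_le_one (by positivity) ((div_le_one hT0).mpr htT) hsε
        _ ≤ _ := by
            have : 0 ≤ (t / T) ^ ε := by positivity
            rw [if_pos htT]
            linarith

/-- Each value u j ≥ t₀ lies in some [t₀ 2^k, t₀ 2^(k+1)), so its r-th power is at most 2^r (t₀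
2^k)^r; exchanging sums produces the level-set sizes. -/
lemma sum_rpow_le_of_dyadic {J : Type*} [Fintype J] (u : J → ℝ) (hu : ∀ j, u j ≤ 1) {r t₀ : ℝ}
    (hr : 0 ≤ r) (ht₀ : 0 < t₀) {K : ℕ} (hK : 1 < t₀ * 2 ^ K) (f : ℝ → ℝ)
    (hf : ∀ t, t₀ ≤ t → t ≤ 1 → t ^ r * (Finset.univ.filter fun j => t ≤ u j).card ≤ f t) :
    ∑ j with t₀ ≤ u j, u j ^ r ≤
      2 ^ r * ∑ k ∈ Finset.range K with t₀ * 2 ^ k ≤ 1, f (t₀ * 2 ^ k) := by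
  set S := {k ∈ Finset.range K | t₀ * 2 ^ k ≤ 1}
  have hpt : ∀ j, t₀ ≤ u j →
      u j ^ r ≤ ∑ k ∈ S, if t₀ * 2 ^ k ≤ u j then 2 ^ r * (t₀ * 2 ^ k) ^ r else 0 := by
    intro j hj
    obtain ⟨k, hk1, hk2⟩ := exists_nat_pow_near ((one_le_div ht₀).mpr hj) one_lt_two
    rw [le_div_iff₀ ht₀, mul_comm] at hk1
    rw [div_lt_iff₀ ht₀, mul_comm] at hk2
    have hkS : k ∈ S := by
      refine Finset.mem_filter.mpr ⟨Finset.mem_range.mpr ?_, hk1.trans (hu j)⟩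
      by_contra! hle
      have : t₀ * 2 ^ K ≤ t₀ * 2 ^ k := by gcongr; norm_num
      linarith [hk1.trans (hu j)]
    refine le_trans ?_ (Finset.single_le_sum (f := fun k =>
      if t₀ * 2 ^ k ≤ u j then 2 ^ r * (t₀ * 2 ^ k) ^ r else 0)
      (fun i _ => by split_ifs <;> positivity) hkS)
    simp only [if_pos hk1]
    rw [← Real.mul_rpow (by norm_num) (by positivity)]
    refine Real.rpow_le_rpow (ht₀.le.trans hj) (hk2.le.trans (le_of_eq ?_)) hr
    ring
  calc _ ≤ ∑ j with t₀ ≤ u j,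
        ∑ k ∈ S, if t₀ * 2 ^ k ≤ u j then 2 ^ r * (t₀ * 2 ^ k) ^ r else 0 :=
        Finset.sum_le_sum fun j hj => hpt j (Finset.mem_filter.mp hj).2
    _ ≤ ∑ j, ∑ k ∈ S, if t₀ * 2 ^ k ≤ u j then 2 ^ r * (t₀ * 2 ^ k) ^ r else 0 :=
        Finset.sum_le_sum_of_subset_of_nonneg (Finset.subset_univ _) fun j _ _ =>
          Finset.sum_nonneg fun k _ => by split_ifs <;> positivity
    _ = 2 ^ r * ∑ k ∈ S, (t₀ * 2 ^ k) ^ r *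
          (Finset.univ.filter fun j => t₀ * 2 ^ k ≤ u j).card := by
        rw [Finset.sum_comm, Finset.mul_sum]
        refine Finset.sum_congr rfl fun k _ => ?_
        rw [← Finset.sum_filter, Finset.sum_const, nsmul_eq_mul]
        ring
    _ ≤ _ := by
        gcongr with k hk
        refine hf _ ?_ (Finset.mem_filter.mp hk).2
        exact le_mul_of_one_le_right ht₀.le (one_le_pow₀ (by norm_num))

lemma two_rpow_neg_lt_one {ε : ℝ} (hε : 0 < ε) : (2 : ℝ) ^ (-ε) < 1 :=
  Real.rpow_lt_one_of_one_lt_of_neg (by norm_num) (by linarith)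

lemma sum_two_rpow_neg_pow_le {ε : ℝ} (hε : 0 < ε) (n : ℕ) :
    ∑ k ∈ Finset.range n, ((2 : ℝ) ^ (-ε)) ^ k ≤ (1 - (2 : ℝ) ^ (-ε))⁻¹ :=
  ((summable_geometric_of_lt_one (by positivity) (two_rpow_neg_lt_one hε)).sum_le_tsum _
    fun _ _ => by positivity).trans_eq
    (tsum_geometric_of_lt_one (by positivity) (two_rpow_neg_lt_one hε))

/-- The terms decay geometrically downwards from the largest index in S, whose term is at most 1. -/
lemma sum_rpow_increasing_le {ε t₀ T : ℝ} (hε : 0 < ε) (ht₀ : 0 < t₀) (hT : 0 < T)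
    (S : Finset ℕ) (hS : ∀ k ∈ S, t₀ * 2 ^ k ≤ T) :
    ∑ k ∈ S, (t₀ * 2 ^ k / T) ^ ε ≤ (1 - (2 : ℝ) ^ (-ε))⁻¹ := by
  have hpos : 0 ≤ (1 - (2 : ℝ) ^ (-ε))⁻¹ :=
    inv_nonneg.mpr (sub_nonneg.mpr (two_rpow_neg_lt_one hε).le)
  rcases S.eq_empty_or_nonempty with rfl | hne
  · simpa using hpos
  set m := S.max' hne
  have hm : t₀ * 2 ^ m ≤ T := hS m (S.max'_mem hne)
  calc _ ≤ ∑ k ∈ S, ((2 : ℝ) ^ (-ε)) ^ (m - k) := by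
        refine Finset.sum_le_sum fun k hk => ?_
        have hkm : k ≤ m := S.le_max' k hk
        have h2 : ((2 : ℝ) ^ (-ε)) ^ (m - k) = ((2 ^ (m - k))⁻¹ : ℝ) ^ ε := by
          rw [Real.inv_rpow (by positivity), Real.rpow_neg (by norm_num), inv_pow,
            ← Real.rpow_mul_natCast (by norm_num), mul_comm, Real.rpow_natCast_mul (by norm_num)]
        rw [h2]
        refine Real.rpow_le_rpow (by positivity) ?_ hε.le
        rw [div_le_iff₀ hT, inv_mul_eq_div, le_div_iff₀ (by positivity), mul_assoc, ← pow_add,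
          Nat.add_sub_cancel' hkm]
        exact hm
    _ ≤ ∑ k ∈ Finset.range (m + 1), ((2 : ℝ) ^ (-ε)) ^ (m - k) :=
        Finset.sum_le_sum_of_subset_of_nonneg
          (fun k hk => Finset.mem_range_succ_iff.mpr (S.le_max' k hk)) fun _ _ _ => by positivity
    _ = ∑ k ∈ Finset.range (m + 1), ((2 : ℝ) ^ (-ε)) ^ k :=
        Finset.sum_range_reflect (fun k => ((2 : ℝ) ^ (-ε)) ^ k) (m + 1)
    _ ≤ _ := sum_two_rpow_neg_pow_le hε _

lemma sum_levelProfile_le {ε t₀ T : ℝ} (hε : 0 < ε) (ht₀ : 0 < t₀) (hT : 0 < T) (K : ℕ) :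
    ∑ k ∈ Finset.range K with t₀ * 2 ^ k ≤ 1, levelProfile ε t₀ T (t₀ * 2 ^ k) ≤
      3 * (1 - (2 : ℝ) ^ (-ε))⁻¹ := by
  simp_rw [levelProfile, Finset.sum_add_distrib]
  have h1 : ∑ k ∈ Finset.range K with t₀ * 2 ^ k ≤ 1, (t₀ / (t₀ * 2 ^ k)) ^ ε ≤
      (1 - (2 : ℝ) ^ (-ε))⁻¹ := by
    refine le_trans ?_ (sum_two_rpow_neg_pow_le hε K)
    refine (Finset.sum_le_sum_of_subset_of_nonneg (Finset.filter_subset _ _)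
      fun _ _ _ => by positivity).trans (le_of_eq ?_)
    refine Finset.sum_congr rfl fun k _ => ?_
    rw [div_mul_cancel_left₀ ht₀.ne', ← Real.rpow_natCast, ← Real.rpow_natCast,
      ← Real.rpow_mul (by norm_num), ← Real.rpow_neg (by norm_num), ← Real.rpow_mul (by norm_num)]
    ring_nf
  have h2 : ∑ k ∈ Finset.range K with t₀ * 2 ^ k ≤ 1, (t₀ * 2 ^ k) ^ ε ≤
      (1 - (2 : ℝ) ^ (-ε))⁻¹ := by
    simpa using sum_rpow_increasing_le hε ht₀ one_pos
      ((Finset.range K).filter fun k => t₀ * 2 ^ k ≤ 1) fun k hk => (Finset.mem_filter.mp hk).2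
  have h3 : (∑ k ∈ Finset.range K with t₀ * 2 ^ k ≤ 1,
      if t₀ * 2 ^ k ≤ T then (t₀ * 2 ^ k / T) ^ ε else 0) ≤ (1 - (2 : ℝ) ^ (-ε))⁻¹ := by
    rw [← Finset.sum_filter]
    exact sum_rpow_increasing_le hε ht₀ hT _ fun k hk => (Finset.mem_filter.mp hk).2
  linarith

end Dyadic

/-! ### The moment bound, rescaling, and coordinates on the paraboloid. -/

section Assembly

/-- The bound for the `r`-th moment of the extension of a normalized function. -/
def momentBound (h : ℕ) (ε : ℝ) : ℝ :=
  1 + 2 ^ (2 + 4 / (2 * h + 1) : ℝ) * (64 * (3 * (1 - (2 : ℝ) ^ (-ε))⁻¹))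

lemma momentBound_nonneg (h : ℕ) {ε : ℝ} (hε : 0 < ε) : 0 ≤ momentBound h ε := by
  have := inv_nonneg.mpr (sub_nonneg.mpr (two_rpow_neg_lt_one hε).le)
  rw [momentBound]
  positivity

section Graph

variable {F : Type*} [Field F] [Fintype F] [DecidableEq F] {χ : AddChar F ℂ}
variable {ι : Type*} [Fintype ι] [DecidableEq ι]

lemma sum_rpow_graphExtension_le (hq : Fintype.card F % 4 = 3) (hχ : χ ≠ 1)
    {h : ℕ} (hh : Odd h) (h3 : 3 ≤ h) (hι : Fintype.card ι = 2 * h) {ε : ℝ} (hε : 0 < ε)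
    (hεd : ε ≤ 4 / (2 * h + 1)) (hε' : ε ≤ 1 / 100) {φ : (ι → F) → ℂ}
    (hφ : ∑ p, ‖φ p‖ ^ 2 ≤ (Fintype.card F : ℝ) ^ Fintype.card ι) :
    ∑ m, ‖graphExtension χ φ m‖ ^ (2 + 4 / (2 * h + 1) : ℝ) ≤ momentBound h ε := by
  set q : ℝ := (Fintype.card F : ℝ) with hqdef
  have hq1 : 1 ≤ q := by rw [hqdef]; exact_mod_cast Fintype.card_pos
  have hq0 : 0 < q := one_pos.trans_le hq1
  set t₀ : ℝ := q ^ (-(2 * h + 1) / 4 : ℝ) with ht₀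
  have ht₀0 : 0 < t₀ := by positivity
  set T : ℝ := √2 * q ^ (-h / 2 : ℝ)
  have hT0 : 0 < T := by positivity
  set r : ℝ := 2 + 4 / (2 * h + 1) with hr
  have hr0 : 0 < r := by positivity
  set u : (ι → F) × F → ℝ := fun m => ‖graphExtension χ φ m‖
  have hu0 : ∀ m, 0 ≤ u m := fun m => norm_nonneg _
  obtain ⟨K, hK⟩ := pow_unbounded_of_one_lt t₀⁻¹ (one_lt_two : (1 : ℝ) < 2)
  have hK' : 1 < t₀ * 2 ^ K := by rwa [inv_lt_iff_one_lt_mul₀ ht₀0, mul_comm] at hK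
  have hhigh : ∑ m with t₀ ≤ u m, u m ^ r ≤ 2 ^ r * (64 * (3 * (1 - (2 : ℝ) ^ (-ε))⁻¹)) := by
    refine (sum_rpow_le_of_dyadic u (norm_graphExtension_le_one hφ) hr0.le ht₀0 hK'
      (fun t => 64 * levelProfile ε t₀ T t) fun t ht ht1 => ?_).trans ?_
    · obtain ⟨h1, h2⟩ := sq_mul_sq_card_le hq hχ hh hι hφ (ht₀0.trans_le ht)
        (Finset.univ.filter fun m => t ≤ u m) fun m hm => (Finset.mem_filter.mp hm).2
      exact rpow_mul_le_levelProfile h3 hh hq1 (Nat.cast_nonneg _) ht₀ ht ht1 hε hεd hε' h1 h2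
    · rw [← Finset.mul_sum]
      gcongr
      exact sum_levelProfile_le hε ht₀0 hT0 K
  -- Parseval gives total L² mass at most q, and t₀ is chosen so that t₀^(4/d) q = 1.
  have hlow : ∑ m with ¬ t₀ ≤ u m, u m ^ r ≤ 1 := by
    have hsum : ∑ m, u m ^ 2 ≤ q := by
      have h1 := sum_norm_sq_graphExtension hχ φ
      rw [← hqdef] at h1
      have h2 : 0 < q ^ Fintype.card ι := by positivity
      refine le_of_mul_le_mul_left ?_ h2
      rw [h1, mul_comm q]
      gcongr
    calc _ ≤ ∑ m with ¬ t₀ ≤ u m, t₀ ^ (4 / (2 * h + 1) : ℝ) * u m ^ 2 := by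
          refine Finset.sum_le_sum fun m hm => ?_
          rw [hr, Real.rpow_add' (hu0 m) hr0.ne', Real.rpow_two, mul_comm]
          gcongr
          exact (not_le.mp (Finset.mem_filter.mp hm).2).le
      _ ≤ ∑ m, t₀ ^ (4 / (2 * h + 1) : ℝ) * u m ^ 2 :=
          Finset.sum_le_sum_of_subset_of_nonneg (Finset.subset_univ _) fun _ _ _ => by positivity
      _ ≤ t₀ ^ (4 / (2 * h + 1) : ℝ) * q := by
          rw [← Finset.mul_sum]
          gcongr
      _ = 1 := by
          rw [ht₀, ← Real.rpow_mul hq0.le, div_mul_div_comm, mul_comm (4 : ℝ), neg_mul, neg_div,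
            div_self (by positivity), Real.rpow_neg_one, inv_mul_cancel₀ hq0.ne']
  rw [← Finset.sum_filter_add_sum_filter_not Finset.univ (fun m => t₀ ≤ u m), momentBound]
  linarith

/-- Both sides are homogeneous in φ: division by its normalized L² norm A reduces to the moment
bound, and A = 0 forces φ = 0. -/
lemma rpow_sum_graphExtension_le (hq : Fintype.card F % 4 = 3) (hχ : χ ≠ 1)
    {h : ℕ} (hh : Odd h) (h3 : 3 ≤ h) (hι : Fintype.card ι = 2 * h) {ε : ℝ} (hε : 0 < ε)
    (hεd : ε ≤ 4 / (2 * h + 1)) (hε' : ε ≤ 1 / 100) {r : ℝ} (hr : r = 2 + 4 / (2 * h + 1))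
    (φ : (ι → F) → ℂ) :
    (∑ m, ‖graphExtension χ φ m‖ ^ r) ^ (1 / r) ≤ momentBound h ε ^ (1 / r) *
      (((Fintype.card F : ℝ) ^ Fintype.card ι)⁻¹ * ∑ p, ‖φ p‖ ^ (2 : ℝ)) ^ (1 / 2 : ℝ) := by
  have hr0 : 0 < r := by rw [hr]; positivity
  have hN : (0 : ℝ) < (Fintype.card F : ℝ) ^ Fintype.card ι :=
    pow_pos (by exact_mod_cast Fintype.card_pos) _
  simp_rw [Real.rpow_two]
  set N : ℝ := (Fintype.card F : ℝ) ^ Fintype.card ι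
  have hS : 0 ≤ ∑ p, ‖φ p‖ ^ 2 := Finset.sum_nonneg fun _ _ => sq_nonneg _
  set A : ℝ := (N⁻¹ * ∑ p, ‖φ p‖ ^ 2) ^ (1 / 2 : ℝ) with hA
  have hA0 : 0 ≤ A := by positivity
  have hA2 : A ^ 2 = N⁻¹ * ∑ p, ‖φ p‖ ^ 2 := by
    rw [hA, ← Real.sqrt_eq_rpow, Real.sq_sqrt (by positivity)]
  rcases hA0.eq_or_lt with h0 | hA0
  · have hz : ∀ p, φ p = 0 := by
      rw [← h0, zero_pow two_ne_zero, eq_comm, mul_eq_zero, inv_eq_zero] at hA2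
      have := (Finset.sum_eq_zero_iff_of_nonneg fun _ _ => sq_nonneg _).mp
        (hA2.resolve_left hN.ne')
      exact fun p => by simpa using this p (Finset.mem_univ p)
    have : ∀ m, graphExtension χ φ m = 0 := fun m => by simp [graphExtension, hz]
    simp [this, Real.zero_rpow hr0.ne', Real.zero_rpow (inv_ne_zero hr0.ne'), ← h0]
  have hscale : ∀ m, ‖graphExtension χ φ m‖ =
      A * ‖graphExtension χ (fun p => (A : ℂ)⁻¹ * φ p) m‖ := by
    intro m
    have hAC : (A : ℂ) ≠ 0 := by exact_mod_cast hA0.ne'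
    have : graphExtension χ φ m = A * graphExtension χ (fun p => (A : ℂ)⁻¹ * φ p) m := by
      simp_rw [graphExtension, mul_assoc ((A : ℂ)⁻¹), ← Finset.mul_sum]
      field_simp
    rw [this, norm_mul, Complex.norm_real, Real.norm_of_nonneg hA0.le]
  have hφ' : ∑ p, ‖(A : ℂ)⁻¹ * φ p‖ ^ 2 ≤ N := by
    simp_rw [norm_mul, mul_pow, ← Finset.mul_sum, norm_inv, Complex.norm_real,
      Real.norm_of_nonneg hA0.le, inv_pow, hA2]
    have hne : ∑ p, ‖φ p‖ ^ 2 ≠ 0 := fun h => by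
      rw [h, mul_zero] at hA2
      exact hA0.ne' (pow_eq_zero_iff two_ne_zero |>.mp hA2)
    apply le_of_eq
    field_simp
  have hmain := sum_rpow_graphExtension_le hq hχ hh h3 hι hε hεd hε' hφ'
  rw [← hr] at hmain
  simp_rw [hscale, Real.mul_rpow hA0.le (norm_nonneg _), ← Finset.mul_sum]
  have hsum : 0 ≤ ∑ m, ‖graphExtension χ (fun p => (A : ℂ)⁻¹ * φ p) m‖ ^ r :=
    Finset.sum_nonneg fun _ _ => Real.rpow_nonneg (norm_nonneg _) _
  rw [Real.mul_rpow (by positivity) hsum, ← Real.rpow_mul hA0.le,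
    mul_one_div_cancel hr0.ne', Real.rpow_one, mul_comm]
  gcongr

end Graph

section Coordinates

variable {F : Type*} [Field F] [Fintype F] [DecidableEq F] {χ : AddChar F ℂ} {n : ℕ}

/-- The point of the paraboloid above `p`. -/
def graphPoint (p : Fin n → F) : Fin (n + 1) → F :=
  Fin.snoc (α := fun _ => F) p (p ⬝ᵥ p)

lemma sum_paraboloid {R : Type*} [AddCommMonoid R] (f : (Fin (n + 1) → F) → R) :
    ∑ x ∈ paraboloid F n, f x = ∑ p, f (graphPoint p) := by
  symm
  refine Finset.sum_nbij' graphPoint (fun x => Fin.init (α := fun _ => F) x) ?_ ?_ ?_ ?_ ?_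
  · intro p _
    simp [paraboloid, graphPoint, dotProduct, sq]
  · intro x _
    simp
  · intro p _
    simp [graphPoint]
  · intro x hx
    have h : Fin.init (α := fun _ => F) x ⬝ᵥ Fin.init (α := fun _ => F) x = x (Fin.last n) := by
      simp only [paraboloid, Finset.mem_filter, Finset.mem_univ, true_and] at hx
      simp [hx, dotProduct, Fin.init, sq]
    rw [graphPoint, h, Fin.snoc_init_self]
  · intro p _
    rfl

lemma card_paraboloid : (paraboloid F n).card = Fintype.card F ^ n := by
  rw [Finset.card_eq_sum_ones, sum_paraboloid]
  simp

lemma dotProduct_snoc_graphPoint (y p : Fin n → F) (a : F) :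
    (Fin.snoc (α := fun _ => F) y a : Fin (n + 1) → F) ⬝ᵥ graphPoint p =
      p ⬝ᵥ y + a * (p ⬝ᵥ p) := by
  rw [dotProduct_comm p y, dotProduct, Fin.sum_univ_castSucc]
  simp [graphPoint, dotProduct]

lemma extension_paraboloid_snoc (f : (Fin (n + 1) → F) → ℂ) (m : (Fin n → F) × F) :
    extension χ (paraboloid F n) f (Fin.snoc (α := fun _ => F) m.1 m.2) =
      graphExtension χ (fun p => f (graphPoint p)) m := by
  rw [extension, graphExtension, sum_paraboloid, card_paraboloid, Fintype.card_fin]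
  simp_rw [dotProduct_snoc_graphPoint]
  push_cast
  congr 1
  exact Finset.sum_congr rfl fun _ _ => mul_comm _ _

lemma normCount_extension_paraboloid (r : ℝ) (f : (Fin (n + 1) → F) → ℂ) :
    normCount r (extension χ (paraboloid F n) f) =
      (∑ m, ‖graphExtension χ (fun p => f (graphPoint p)) m‖ ^ r) ^ (1 / r) := by
  rw [normCount, ← Equiv.sum_comp ((Equiv.prodComm _ _).trans (Fin.snocEquiv fun _ => F))]
  congr 1
  refine Finset.sum_congr rfl fun m _ => ?_
  rw [← extension_paraboloid_snoc]
  rfl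

lemma normSurface_paraboloid (s : ℝ) (f : (Fin (n + 1) → F) → ℂ) :
    normSurface (paraboloid F n) s f =
      (((Fintype.card F : ℝ) ^ n)⁻¹ * ∑ p, ‖f (graphPoint p)‖ ^ s) ^ (1 / s) := by
  rw [normSurface, sum_paraboloid, card_paraboloid]
  push_cast
  rfl

end Coordinates

end Assembly

end FiniteFieldExtension

end

theorem theorem1p4 (k n : ℕ) (hk : 1 ≤ k) (hd : n + 1 = 4 * k + 3) :
    ∃ C : ℝ≥0, ∀ (F : Type*) [Field F] [Fintype F] [DecidableEq F], Fintype.card F % 4 = 3 →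
      ∀ χ : AddChar F ℂ, χ ≠ 1 →
        FiniteFieldExtension.extensionConstant χ (FiniteFieldExtension.paraboloid F n) 2
          ((2 * ((n + 1 : ℕ) : ℝ) + 4) / ((n + 1 : ℕ) : ℝ)) ≤ C := by
  set h : ℕ := 2 * k + 1 with hh
  have hn : n = 2 * h := by omega
  set r : ℝ := (2 * ((n + 1 : ℕ) : ℝ) + 4) / ((n + 1 : ℕ) : ℝ) with hr
  have hr' : r = 2 + 4 / (2 * h + 1) := by
    rw [hr, hn]
    push_cast
    field_simp
  -- The value 4/d serves the t^(4/d) terms. The value 1/100 lies below all remaining exponent gaps,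
  -- the smallest lower bound used being 2/7 - 4/15 = 2/105.
  set ε : ℝ := min (4 / (2 * h + 1)) (1 / 100) with hε
  have hε0 : 0 < ε := lt_min (by positivity) (by norm_num)
  have hM := FiniteFieldExtension.momentBound_nonneg h hε0
  refine ⟨⟨FiniteFieldExtension.momentBound h ε ^ (1 / r), Real.rpow_nonneg hM _⟩, ?_⟩
  intro F _ _ _ hq χ hχ
  refine iInf₂_le _ fun f => ?_
  rw [FiniteFieldExtension.normCount_extension_paraboloid,
    FiniteFieldExtension.normSurface_paraboloid]
  have := FiniteFieldExtension.rpow_sum_graphExtension_le (ι := Fin n) hq hχ ⟨k, hh⟩ (by omega)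
    (by rw [Fintype.card_fin, hn]) hε0 (min_le_left _ _) (min_le_right _ _) hr'
    (fun p => f (FiniteFieldExtension.graphPoint p))
  rwa [Fintype.card_fin] at this
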